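/- Let $n\ge 0$ and $d\ge 1$ be integers and let $P\in\mathbb{C}[x_0,\dots,x_n]$ be a nonzero form of degree $d$. The rank $\mathrm{r}(P)$ is the minimal $r$ such that $P=L_1^d+\cdots+L_r^d$ for some linear forms $L_1,\dots,L_r\in\mathbb{C}[x_0,\dots,x_n]$. Let $X_{n,d}\subset\mathbb{P}^{N}$, $N=\binom{n+d}{d}-1$, be the Veronese variety of the classes $[L^d]$ of $d$-th powers of nonzero linear forms in the projective space of degree $d$ forms. A zero-dimensional closed subscheme $Z\subset\mathbb{P}^N$ is called curvilinear if its Zariski tangent space at each of its points has dimension at most $1$; $\langle Z\rangle$ denotes the intersection of all hyperplanes that contain the scheme $Z$. The curvilinear rank of $P$ is $$\mathrm{Cr}(P):=\min\{\deg(Z)\;:\; Z\subset X_{n,d}\text{ a zero-dimensional curvilinear subscheme with }[P]\in\langle Z\rangle\}.$$ Both minima are taken over nonempty sets, and $$\mathrm{r}(P)\le(\mathrm{Cr}(P)-1)\,d+2-\mathrm{Cr}(P).$$ -/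

import Mathlib

open MvPolynomial Filter

noncomputable section

namespace CurvilinearRank

/-- A closed subscheme of the complex projective space whose homogeneous coordinates are indexed
by `σ`, given by its saturated homogeneous ideal in `ℂ[y_i : i ∈ σ]`
(the unit ideal is the empty subscheme). -/
structure ProjSubscheme (σ : Type*) where
  ideal : Ideal (MvPolynomial σ ℂ)
  homogeneous : ∀ F ∈ ideal, ∀ t : ℕ, homogeneousComponent t F ∈ ideal
  saturated : ∀ F : MvPolynomial σ ℂ, (∀ i, X i * F ∈ ideal) → F ∈ ideal

namespace ProjSubscheme

variable {σ : Type*}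

/-- The Hilbert function `t ↦ dim (S/I)_t`. -/
def hilbertFunction (Z : ProjSubscheme σ) (t : ℕ) : ℕ :=
  Module.finrank ℂ (homogeneousSubmodule σ ℂ t ⧸
    (Z.ideal.restrictScalars ℂ).submoduleOf (homogeneousSubmodule σ ℂ t))

/-- `Z` is zero-dimensional (or empty, if `k = 0`) of degree (length) `k`:
its Hilbert polynomial is the constant `k`. -/
def IsZeroDimOfDegree (Z : ProjSubscheme σ) (k : ℕ) : Prop :=
  ∀ᶠ t in atTop, Z.hilbertFunction t = k

/-- The point with homogeneous coordinates `v` lies on `Z`. -/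
def HasPoint (Z : ProjSubscheme σ) (v : σ → ℂ) : Prop :=
  v ≠ 0 ∧ ∀ F ∈ Z.ideal, eval v F = 0

/-- The Zariski tangent space of `Z` at the point `[v]`, as a subspace of `ℂ^σ / ℂ v`, the tangent
space of the projective space at `[v]`: the classes of the vectors that are killed by the
differentials at `v` of all the equations of `Z`. -/
def tangentSpace [Fintype σ] (Z : ProjSubscheme σ) (v : σ → ℂ) :
    Submodule ℂ ((σ → ℂ) ⧸ Submodule.span ℂ {v}) :=
  Submodule.map (Submodule.span ℂ {v}).mkQ
    (⨅ F ∈ Z.ideal,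
      LinearMap.ker (∑ i, eval v (pderiv i F) • (LinearMap.proj i : (σ → ℂ) →ₗ[ℂ] ℂ)))

/-- At each of its points, `Z` has a Zariski tangent space of dimension at most one. -/
def IsCurvilinear [Fintype σ] (Z : ProjSubscheme σ) : Prop :=
  ∀ v, Z.HasPoint v → Module.finrank ℂ (Z.tangentSpace v) ≤ 1

/-- The (affine cone over the) linear span of `Z`: the common zeros of all the linear forms that
vanish on the scheme `Z`. -/
def span (Z : ProjSubscheme σ) : Set (σ → ℂ) :=
  {v | ∀ F ∈ Z.ideal, F.IsHomogeneous 1 → eval v F = 0}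

end ProjSubscheme

/-- Exponents of the monomials of degree `d` in `x_0, …, x_n`; they index the homogeneous
coordinates of the projective space of degree `d` forms. -/
abbrev Expo (n d : ℕ) : Type :=
  {a : Fin (n + 1) →₀ ℕ // a ∈ (Finset.univ : Finset (Fin (n + 1))).finsuppAntidiag d}

/-- The coordinates (coefficients) of a degree `d` form. -/
def coords (n d : ℕ) (P : MvPolynomial (Fin (n + 1)) ℂ) : Expo n d → ℂ :=
  fun a => coeff a.1 P

/-- The (affine cone over the) Veronese variety `X_{n,d}`: all `d`-th powers of linear forms. -/
def veroneseCone (n d : ℕ) : Set (Expo n d → ℂ) :=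
  {v | ∃ L : MvPolynomial (Fin (n + 1)) ℂ, L.IsHomogeneous 1 ∧ v = coords n d (L ^ d)}

/-- `Z` is a subscheme of the Veronese variety `X_{n,d}`. -/
def InVeronese {n d : ℕ} (Z : ProjSubscheme (Expo n d)) : Prop :=
  vanishingIdeal ℂ (veroneseCone n d) ≤ Z.ideal

/-- The numbers `r` such that `P` is a sum of `r` `d`-th powers of linear forms. -/
def powerSumLengths (n d : ℕ) (P : MvPolynomial (Fin (n + 1)) ℂ) : Set ℕ :=
  {r | ∃ L : Fin r → MvPolynomial (Fin (n + 1)) ℂ,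
    (∀ i, (L i).IsHomogeneous 1) ∧ P = ∑ i, L i ^ d}

/-- The rank of a degree `d` form. -/
def rank (n d : ℕ) (P : MvPolynomial (Fin (n + 1)) ℂ) : ℕ :=
  sInf (powerSumLengths n d P)

/-- The degrees of the curvilinear zero-dimensional subschemes of `X_{n,d}` whose span
contains `[P]`. -/
def curvilinearLengths (n d : ℕ) (P : MvPolynomial (Fin (n + 1)) ℂ) : Set ℕ :=
  {k | ∃ Z : ProjSubscheme (Expo n d), Z.IsZeroDimOfDegree k ∧ Z.IsCurvilinear ∧
    InVeronese Z ∧ coords n d P ∈ Z.span}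

/-- The curvilinear rank of a degree `d` form. -/
def curvilinearRank (n d : ℕ) (P : MvPolynomial (Fin (n + 1)) ℂ) : ℕ :=
  sInf (curvilinearLengths n d P)

end CurvilinearRank

end

/-! The rank of a form is bounded by its curvilinear rank. -/

noncomputable section

namespace CurvilinearRank

/-! Let `Z` be curvilinear of degree k with [P] in its span. A general `d`-th power of a linear form
cuts `X_{n,d}` in a hyperplane section missing `Z`, so `Z` lies in an affine chart with a coordinate
ring `A` of dimension at most k (`exists_regular_veroneseLin`, `rank_affineRing_le`). Tangent spaces
of dimension at most one make `A` monogenic, a quotient of ℂ[X] (`exists_aeval_surjective`). The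
affine coordinates become polynomials f_i, and [P] ∈ ⟨Z⟩ turns the coefficients of P, up to
multinomials, into values Φ(∏ f_i^{a_i}) of a functional Φ that kills a nonzero ideal of ℂ[X]
(`exists_curve`).

Let g, of degree K + 1 ≤ k, generate the largest ideal killed by Φ. Modulo g the f_i have degree at
most K, so Φ matters only in degrees up to Kd: P comes from a binary form of degree Kd, and
Sylvester's theorem (`exists_quadrature`) writes Φ there as a combination of Kd + 2 - (K + 1) = K(d
- 1) + 1 evaluations. Each evaluation contributes one `d`-th power, and (k - 1)(d - 1) + 1 is the
stated bound.

For nonemptiness, a sufficiently long scheme at one point of a monomial curve in `X_{n,d}` spans the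
whole space (`curvilinearLengths_nonempty`). -/

/-! ### Apolarity and Sylvester's theorem in one variable. -/

/-- A general member of a pencil without base points is separable. -/
theorem exists_separable_add_C_mul {G b : Polynomial ℂ}
    (hdeg : b.natDegree < G.natDegree) (hc : IsCoprime G b) :
    ∃ c : ℂ, (G + Polynomial.C c * b).Separable := by
  classical
  -- The Wronskian: a double root of G + c·b is a root of W, and it determines c = -G/b. Hence only
  -- finitely many c are bad once W ≠ 0.
  set W : Polynomial ℂ := G * b.derivative - G.derivative * b with hW
  have hW0 : W ≠ 0 := by
    intro h
    have h1 : G ∣ G.derivative := by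
      refine hc.dvd_of_dvd_mul_right (Dvd.intro b.derivative ?_)
      exact sub_eq_zero.1 h
    have h2 : G.derivative = 0 := by
      by_contra hne
      have := Polynomial.natDegree_le_of_dvd h1 hne
      have := Polynomial.natDegree_derivative_lt (p := G) (by omega)
      omega
    have := Polynomial.derivative_eq_zero.1 h2
    omega
  obtain ⟨c, hcS⟩ := Infinite.exists_notMem_finset
    (W.roots.toFinset.image fun α => -G.eval α / b.eval α)
  refine ⟨c, ?_⟩
  rw [Polynomial.separable_def, Polynomial.isCoprime_iff_aeval_ne_zero_of_isAlgClosed ℂ ℂ]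
  intro α
  by_contra! hα
  simp only [Polynomial.coe_aeval_eq_eval, Polynomial.eval_add, Polynomial.eval_mul,
    Polynomial.eval_C, Polynomial.derivative_add, Polynomial.derivative_C_mul] at hα
  obtain ⟨h1, h2⟩ := hα
  have hbα : b.eval α ≠ 0 := by
    intro hb
    rw [hb, mul_zero, add_zero] at h1
    have := (Polynomial.isCoprime_iff_aeval_ne_zero_of_isAlgClosed ℂ ℂ G b).1 hc α
    simp [h1, hb] at this
  refine hcS (Finset.mem_image.2 ⟨α, ?_, ?_⟩)
  · rw [Multiset.mem_toFinset, Polynomial.mem_roots hW0, Polynomial.IsRoot, hW]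
    simp only [Polynomial.eval_sub, Polynomial.eval_mul]
    linear_combination b.derivative.eval α * h1 - b.eval α * h2
  · field_simp
    linear_combination -h1

/-- A polynomial `b` of degree less than `k`, orthogonal under `(p, q) ↦ Φ (p * q)` to all
polynomials of degree less than `k - 1`. -/
theorem exists_orthogonal (Φ : Polynomial ℂ →ₗ[ℂ] ℂ) {k : ℕ} (hk : 1 ≤ k) :
    ∃ b : Polynomial ℂ, b ≠ 0 ∧ b.degree < k ∧
      ∀ q : Polynomial ℂ, q.degree < (k - 1 : ℕ) → Φ (b * q) = 0 := by
  -- There are k unknown coefficients and only k - 1 linear conditions.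
  let E : Polynomial.degreeLT ℂ k →ₗ[ℂ] (Fin (k - 1) → ℂ) :=
    LinearMap.pi fun j => Φ ∘ₗ (LinearMap.mulRight ℂ (Polynomial.X ^ (j : ℕ))) ∘ₗ
      (Polynomial.degreeLT ℂ k).subtype
  have hE : LinearMap.ker E ≠ ⊥ := by
    have : FiniteDimensional ℂ (Polynomial.degreeLT ℂ k) :=
      Module.Finite.equiv (Polynomial.degreeLTEquiv ℂ k).symm
    apply LinearMap.ker_ne_bot_of_finrank_lt
    rw [(Polynomial.degreeLTEquiv ℂ k).finrank_eq]
    simp only [Module.finrank_fin_fun]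
    omega
  obtain ⟨b, hb, hb0⟩ := Submodule.exists_mem_ne_zero_of_ne_bot hE
  refine ⟨b.1, by simpa using hb0, Polynomial.mem_degreeLT.1 b.2, fun q hq => ?_⟩
  have hj : ∀ j < k - 1, Φ (b.1 * Polynomial.X ^ j) = 0 := fun j hj =>
    congrFun (LinearMap.mem_ker.1 hb) ⟨j, hj⟩
  rcases eq_or_ne q 0 with rfl | hq0
  · simp
  · rw [q.as_sum_range' (k - 1) ((Polynomial.natDegree_lt_iff_degree_lt hq0).2 hq),
      Finset.mul_sum, map_sum]
    refine Finset.sum_eq_zero fun j hjm => ?_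
    rw [← Polynomial.C_mul_X_pow_eq_monomial, mul_left_comm, ← Polynomial.smul_eq_C_mul, map_smul,
      hj j (Finset.mem_range.1 hjm), smul_zero]

/-- **Sylvester's theorem**: a functional whose apolar ideal is generated by a polynomial of
degree `k` is, on polynomials of degree at most `D`, a combination of `e = D + 2 - k` point
evaluations. -/
theorem exists_quadrature (Φ : Polynomial ℂ →ₗ[ℂ] ℂ) {g : Polynomial ℂ} (hg : g.Monic)
    (hΦ : ∀ q, Φ (g * q) = 0) (hmax : ∀ p, (∀ q, Φ (p * q) = 0) → g ∣ p)
    (hk : 1 ≤ g.natDegree) {D e : ℕ} (hke : g.natDegree ≤ e) (hD : D + 2 = e + g.natDegree) :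
    ∃ α w : Fin e → ℂ, ∀ q : Polynomial ℂ, q.natDegree ≤ D →
      Φ q = ∑ j, w j * q.eval (α j) := by
  classical
  set k := g.natDegree with hkdef
  have hgdeg : g.degree = k := Polynomial.degree_eq_natDegree hg.ne_zero
  obtain ⟨b, hb0, hbk, hborth⟩ := exists_orthogonal Φ hk
  have hbk' : b.natDegree < k := (Polynomial.natDegree_lt_iff_degree_lt hb0).2 hbk
  -- If α is a common root, write b = (X - α)b'. For any q, the remainder of (X - α)q modulo g is
  -- again divisible by X - α, with cofactor of degree below k - 1. So Φ(bq) = 0 for every q, and g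
  -- would divide b, of smaller degree.
  have hcop : IsCoprime g b := by
    rw [Polynomial.isCoprime_iff_aeval_ne_zero_of_isAlgClosed ℂ ℂ]
    intro α
    by_contra! hα
    simp only [Polynomial.coe_aeval_eq_eval] at hα
    obtain ⟨b', rfl⟩ := Polynomial.dvd_iff_isRoot.2 hα.2
    obtain ⟨g', hg'⟩ := Polynomial.dvd_iff_isRoot.2 hα.1
    have hall : ∀ q, Φ ((Polynomial.X - Polynomial.C α) * b' * q) = 0 := by
      intro q
      set r := ((Polynomial.X - Polynomial.C α) * q) %ₘ g with hr
      have hr1 : r + g * (((Polynomial.X - Polynomial.C α) * q) /ₘ g) =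
        (Polynomial.X - Polynomial.C α) * q := Polynomial.modByMonic_add_div _ g
      have hdvd : (Polynomial.X - Polynomial.C α) ∣ r := by
        have h1 : Polynomial.X - Polynomial.C α ∣
            g * (((Polynomial.X - Polynomial.C α) * q) /ₘ g) := by
          rw [hg', mul_assoc]
          exact dvd_mul_right _ _
        refine (dvd_add_left h1).1 ?_
        rw [hr1]
        exact dvd_mul_right _ _
      obtain ⟨q'', hq''⟩ := hdvd
      have hrdeg : r.degree < k := hgdeg ▸ Polynomial.degree_modByMonic_lt _ hg
      have : Φ ((Polynomial.X - Polynomial.C α) * b' * q'') = 0 := by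
        apply hborth
        rcases eq_or_ne q'' 0 with rfl | hne
        · simp
        · rw [hq'', Polynomial.degree_mul, Polynomial.degree_X_sub_C,
            Polynomial.degree_eq_natDegree hne] at hrdeg
          rw [Polynomial.degree_eq_natDegree hne]
          norm_cast at hrdeg ⊢
          omega
      have e1 : (Polynomial.X - Polynomial.C α) * b' * q =
          (Polynomial.X - Polynomial.C α) * b' * q'' +
            g * (b' * (((Polynomial.X - Polynomial.C α) * q) /ₘ g)) := by
        linear_combination (-b') * hr1 + b' * hq''
      rw [e1, map_add, this, hΦ, add_zero]
    have := Polynomial.degree_le_of_dvd (hmax _ hall) hb0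
    exact absurd hbk (not_lt.2 (hgdeg ▸ this))
  obtain ⟨β, hβ⟩ : ∃ β, b.eval β ≠ 0 := by
    by_contra! h
    exact hb0 (Polynomial.funext fun x => by simpa using h x)
  -- Padding raises the degree of g to e; β is not a root of b, so coprimality survives.
  set m : Polynomial ℂ := (Polynomial.X - Polynomial.C β) ^ (e - k) with hm
  have hmonic : m.Monic := (Polynomial.monic_X_sub_C β).pow _
  have hmdeg : m.natDegree = e - k := by
    rw [hm, Polynomial.natDegree_pow, Polynomial.natDegree_X_sub_C, mul_one]
  have hcop2 : IsCoprime (g * m) b := by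
    refine hcop.mul_left (IsCoprime.pow_left ?_)
    refine (Polynomial.irreducible_X_sub_C β).coprime_iff_not_dvd.2 fun h => ?_
    exact hβ (Polynomial.dvd_iff_isRoot.1 h)
  have hgm : (g * m).natDegree = e := by
    rw [hg.natDegree_mul hmonic, hmdeg]; omega
  obtain ⟨c, hsep⟩ := exists_separable_add_C_mul (b := b) (G := g * m) (by omega) hcop2
  set h := g * m + Polynomial.C c * b with hh
  have hdeglt : (Polynomial.C c * b).degree < (g * m).degree := by
    rw [Polynomial.degree_eq_natDegree (hg.mul hmonic).ne_zero, hgm]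
    rw [← Polynomial.smul_eq_C_mul]
    refine (Polynomial.degree_smul_le c b).trans_lt (hbk.trans_le ?_)
    exact_mod_cast hke
  have hhmonic : h.Monic := (hg.mul hmonic).add_of_left hdeglt
  have hhdeg : h.natDegree = e := by
    rw [← hgm]; exact Polynomial.natDegree_eq_of_degree_eq
      (Polynomial.degree_add_eq_left_of_degree_lt hdeglt)
  have hhorth : ∀ q : Polynomial ℂ, q.degree < (k - 1 : ℕ) → Φ (h * q) = 0 := by
    intro q hq
    rw [hh, add_mul, map_add, mul_assoc, hΦ, mul_assoc, ← Polynomial.smul_eq_C_mul, map_smul,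
      hborth q hq, smul_zero, add_zero]
  have hcard : h.roots.toFinset.card = e := by
    rw [Multiset.toFinset_card_of_nodup (Polynomial.nodup_roots hsep),
      IsAlgClosed.card_roots_eq_natDegree, hhdeg]
  let σ := h.roots.toFinset.equivFinOfCardEq hcard
  let α : Fin e → ℂ := fun j => (σ.symm j).1
  have hα : Function.Injective α := Subtype.val_injective.comp σ.symm.injective
  -- As in Gauss quadrature, the nodes are the roots of h. Dividing q by h leaves a quotient of
  -- degree at most D - e = k - 2, where h is orthogonal, and the remainder is recovered by Lagrange
  -- interpolation.
  refine ⟨α, fun j => Φ (Lagrange.basis Finset.univ α j), fun q hq => ?_⟩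
  set r := q %ₘ h with hr
  have hqr : r + h * (q /ₘ h) = q := Polynomial.modByMonic_add_div _ h
  have hroot : ∀ j, h.eval (α j) = 0 := fun j => by
    have := (σ.symm j).2
    rw [Multiset.mem_toFinset, Polynomial.mem_roots hhmonic.ne_zero] at this
    exact this
  have h0 : Φ (h * (q /ₘ h)) = 0 := by
    apply hhorth
    rcases eq_or_ne (q /ₘ h) 0 with h00 | hne
    · simp [h00]
    · rw [Polynomial.degree_eq_natDegree hne]
      have hle : ¬ q.degree < h.degree := fun hlt =>
        hne ((Polynomial.divByMonic_eq_zero_iff hhmonic).2 hlt)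
      have h1 := Polynomial.natDegree_divByMonic q hhmonic
      have h2 : h.natDegree ≤ q.natDegree := Polynomial.natDegree_le_natDegree (not_lt.1 hle)
      norm_cast
      omega
  have hrdeg : r.degree < (Finset.univ : Finset (Fin e)).card := by
    have := Polynomial.degree_modByMonic_lt q hhmonic
    rwa [Polynomial.degree_eq_natDegree hhmonic.ne_zero, hhdeg, ← Finset.card_fin e] at this
  have hrint := Lagrange.eq_interpolate (v := α) (s := Finset.univ) hα.injOn hrdeg
  have hqe : ∀ j, q.eval (α j) = r.eval (α j) := fun j => by
    conv_lhs => rw [← hqr]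
    simp [hroot j]
  calc Φ q = Φ r := by conv_lhs => rw [← hqr, map_add, h0, add_zero]
    _ = _ := by
      conv_lhs => rw [hrint, Lagrange.interpolate_apply]
      rw [map_sum]
      refine Finset.sum_congr rfl fun j _ => ?_
      rw [← Polynomial.smul_eq_C_mul, map_smul, smul_eq_mul, hqe, mul_comm]

/-! ### Finite algebras generated by one element. -/

section Monogenic

variable {A : Type*} [CommRing A] [Algebra ℂ A] [Module.Finite ℂ A]

/-- Every residue field of a finite `ℂ`-algebra is `ℂ`. -/
theorem exists_algHom_ker_eq (m : Ideal A) [hm : m.IsMaximal] :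
    ∃ ε : A →ₐ[ℂ] ℂ, ∀ a, ε a = 0 ↔ a ∈ m := by
  let _ := Ideal.Quotient.field m
  let E : ℂ ≃ₐ[ℂ] A ⧸ m := AlgEquiv.ofBijective (Algebra.ofId ℂ (A ⧸ m))
    (IsAlgClosed.algebraMap_bijective_of_isIntegral (k := ℂ) (K := A ⧸ m))
  refine ⟨E.symm.toAlgHom.comp (Ideal.Quotient.mkₐ ℂ m), fun a => ?_⟩
  simp [Ideal.Quotient.eq_zero_iff_mem]

/-- If `s` separates the maximal ideals and generates their cotangent spaces, then `s - c`
generates an ideal of codimension at most one. -/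
theorem exists_eq_algebraMap_add_mul (s : A) (l : MaximalSpectrum A → ℂ)
    (hl : Function.Injective l) (hs : ∀ m : MaximalSpectrum A, s - algebraMap ℂ A (l m) ∈ m.asIdeal)
    (hgen : ∀ m : MaximalSpectrum A,
      m.asIdeal ≤ Ideal.span {s - algebraMap ℂ A (l m)} ⊔ m.asIdeal ^ 2)
    (c : ℂ) (a : A) : ∃ (z : ℂ) (b : A), a = algebraMap ℂ A z + (s - algebraMap ℂ A c) * b := by
  have : IsNoetherianRing A := IsNoetherianRing.of_finite ℂ A
  set J : Ideal A := Ideal.span {s - algebraMap ℂ A c} with hJ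
  by_cases htop : J = ⊤
  · have : a ∈ J := htop ▸ Submodule.mem_top
    obtain ⟨b, hb⟩ := Ideal.mem_span_singleton.1 this
    exact ⟨0, b, by rw [map_zero, zero_add, hb]⟩
  obtain ⟨M, hM, hJM⟩ := Ideal.exists_le_maximal J htop
  have hlam : ∀ m : MaximalSpectrum A, J ≤ m.asIdeal → l m = c := by
    intro m hm
    by_contra hne
    have h1 : algebraMap ℂ A (l m - c) ∈ m.asIdeal := by
      have := sub_mem (hm (Ideal.mem_span_singleton_self _)) (hs m)
      rw [map_sub]
      convert this using 1
      ring
    exact m.isMaximal.ne_top (Ideal.eq_top_of_isUnit_mem _ h1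
      ((IsUnit.mk0 _ (sub_ne_zero.2 hne)).map _))
  -- Injectivity of l makes M the only maximal ideal above J, which is what Nakayama's lemma needs
  -- to give M ≤ J.
  have hjac : M ≤ J.jacobson := by
    refine le_sInf fun m' hm' => ?_
    have h1 := hlam ⟨m', hm'.2⟩ hm'.1
    have h2 := hlam ⟨M, hM⟩ hJM
    have := congrArg MaximalSpectrum.asIdeal (hl (h1.trans h2.symm))
    exact this.ge
  have hMJ : M ≤ J := by
    have h2 : M ≤ J ⊔ M • M := by
      have := hgen ⟨M, hM⟩
      rw [hlam ⟨M, hM⟩ hJM] at this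
      rwa [smul_eq_mul, ← sq]
    have := Submodule.sup_smul_eq_sup_smul_of_le_smul_of_le_jacobson
      (IsNoetherian.noetherian M) hjac h2
    rw [this] at h2
    exact h2.trans (sup_le le_rfl (by rw [smul_eq_mul]; exact Ideal.mul_le_left))
  obtain ⟨ε, hε⟩ := exists_algHom_ker_eq M
  have hz : a - algebraMap ℂ A (ε a) ∈ M := (hε _).1 (by simp)
  obtain ⟨b, hb⟩ := Ideal.mem_span_singleton.1 (hMJ hz)
  exact ⟨ε a, b, by rw [← hb]; ring⟩

/-- A finite `ℂ`-algebra whose cotangent spaces have dimension at most one is generated by one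
element. -/
theorem exists_aeval_surjective
    (h : ∀ m : Ideal A, m.IsMaximal → ∃ π ∈ m, m ≤ Ideal.span {π} ⊔ m ^ 2) :
    ∃ s : A, Function.Surjective (Polynomial.aeval (R := ℂ) s) := by
  have : IsArtinianRing A := IsArtinianRing.of_finite ℂ A
  obtain ⟨N, ⟨eN⟩⟩ := Finite.exists_equiv_fin (MaximalSpectrum A)
  let l : MaximalSpectrum A → ℂ := fun m => ((eN m : ℕ) : ℂ)
  have hl : Function.Injective l := fun m m' hmm => by
    simpa [l, Fin.val_inj] using hmm
  choose π hπ hgenπ using fun m : MaximalSpectrum A => h m.asIdeal m.isMaximal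
  have hcop : Pairwise (Function.onFun IsCoprime fun m : MaximalSpectrum A => m.asIdeal ^ 2) := by
    intro m m' hne
    refine IsCoprime.pow ?_
    rw [Ideal.isCoprime_iff_sup_eq]
    exact Ideal.IsMaximal.coprime_of_ne m.isMaximal m'.isMaximal
      fun heq => hne (MaximalSpectrum.ext heq)
  -- By the Chinese remainder theorem modulo the squares, s takes distinct values at the points and
  -- is there a uniformizer up to a constant.
  obtain ⟨s, hs⟩ := Ideal.exists_forall_sub_mem_ideal hcop
    fun m => algebraMap ℂ A (l m) + π m
  have hsm : ∀ m : MaximalSpectrum A, s - algebraMap ℂ A (l m) ∈ m.asIdeal := fun m => by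
    have := add_mem (Ideal.pow_le_self two_ne_zero (hs m)) (hπ m)
    convert this using 1; ring
  have hgen : ∀ m : MaximalSpectrum A,
      m.asIdeal ≤ Ideal.span {s - algebraMap ℂ A (l m)} ⊔ m.asIdeal ^ 2 := fun m => by
    refine (hgenπ m).trans (sup_le ?_ le_sup_right)
    rw [Ideal.span_singleton_le_iff_mem]
    have h1 : s - algebraMap ℂ A (l m) ∈
        Ideal.span {s - algebraMap ℂ A (l m)} ⊔ m.asIdeal ^ 2 :=
      Ideal.mem_sup_left (Ideal.mem_span_singleton_self _)
    have := sub_mem h1 (Ideal.mem_sup_right (hs m))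
    convert this using 1; ring
  refine ⟨s, ?_⟩
  -- Repeated division by the s - c. With S the roots of the minimal polynomial of s, the remaining
  -- product vanishes.
  have key : ∀ (S : Multiset ℂ) (a : A), ∃ (p : Polynomial ℂ) (b : A), a = Polynomial.aeval s p +
      Polynomial.aeval s (S.map fun c => Polynomial.X - Polynomial.C c).prod * b := by
    intro S
    induction S using Multiset.induction_on with
    | empty => exact fun a => ⟨0, a, by simp⟩
    | cons c S ih =>
      intro a
      obtain ⟨p, b, hab⟩ := ih a
      obtain ⟨z, b', hb⟩ := exists_eq_algebraMap_add_mul s l hl hsm hgen c b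
      refine ⟨p + (S.map fun c => Polynomial.X - Polynomial.C c).prod * Polynomial.C z, b', ?_⟩
      rw [hab, hb]
      simp only [Multiset.map_cons, Multiset.prod_cons, map_add, map_mul, map_sub,
        Polynomial.aeval_C, Polynomial.aeval_X]
      ring
  have hint : IsIntegral ℂ s := Algebra.IsIntegral.isIntegral s
  intro a
  obtain ⟨p, b, hab⟩ := key (minpoly ℂ s).roots a
  rw [← (IsAlgClosed.splits (minpoly ℂ s)).eq_prod_roots_of_monic (minpoly.monic hint),
    minpoly.aeval, zero_mul, add_zero] at hab
  exact ⟨p, hab.symm⟩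

end Monogenic

/-! ### Affine charts of a projective scheme. -/

section Affine

variable {σ : Type*}

theorem homogeneousComponent_zero_mul {l : MvPolynomial σ ℂ} (hl : l.IsHomogeneous 1)
    (H : MvPolynomial σ ℂ) : homogeneousComponent 0 (l * H) = 0 := by
  have h0 : constantCoeff l = 0 := hl.coeff_eq_zero (by simp)
  rw [homogeneousComponent_zero, ← constantCoeff_eq, map_mul, h0, zero_mul, C_0]

theorem homogeneousComponent_succ_mul {l : MvPolynomial σ ℂ} (hl : l.IsHomogeneous 1)
    (H : MvPolynomial σ ℂ) (j : ℕ) :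
    homogeneousComponent (j + 1) (l * H) = l * homogeneousComponent j H := by
  conv_lhs => rw [← sum_homogeneousComponent H, Finset.mul_sum, map_sum]
  have hterm : ∀ i, homogeneousComponent (j + 1) (l * homogeneousComponent i H) =
      if j = i then l * homogeneousComponent i H else 0 := fun i => by
    rw [homogeneousComponent_of_mem
      (hl.mul (homogeneousComponent_isHomogeneous i H) : (_ : MvPolynomial σ ℂ) ∈ _)]
    split_ifs <;> first | rfl | omega
  simp_rw [hterm]
  rw [Finset.sum_ite_eq]
  split_ifs with h
  · rfl
  · rw [homogeneousComponent_eq_zero, mul_zero]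
    simpa using h

namespace ProjSubscheme

/-- The ideal of the affine scheme `Z ∩ {l = 1}`. -/
def affineIdeal (Z : ProjSubscheme σ) (l : MvPolynomial σ ℂ) : Ideal (MvPolynomial σ ℂ) :=
  Z.ideal ⊔ Ideal.span {l - 1}

/-- The coordinate ring of the affine scheme `Z ∩ {l = 1}`. -/
def AffineRing (Z : ProjSubscheme σ) (l : MvPolynomial σ ℂ) : Type _ :=
  MvPolynomial σ ℂ ⧸ Z.affineIdeal l

instance (Z : ProjSubscheme σ) (l : MvPolynomial σ ℂ) : CommRing (Z.AffineRing l) :=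
  inferInstanceAs (CommRing (MvPolynomial σ ℂ ⧸ Z.affineIdeal l))

instance (Z : ProjSubscheme σ) (l : MvPolynomial σ ℂ) : Algebra ℂ (Z.AffineRing l) :=
  inferInstanceAs (Algebra ℂ (MvPolynomial σ ℂ ⧸ Z.affineIdeal l))

/-- Restriction of polynomials to `Z ∩ {l = 1}`. -/
def restr (Z : ProjSubscheme σ) (l : MvPolynomial σ ℂ) : MvPolynomial σ ℂ →ₐ[ℂ] Z.AffineRing l :=
  Ideal.Quotient.mkₐ ℂ (Z.affineIdeal l)

variable (Z : ProjSubscheme σ) {l : MvPolynomial σ ℂ}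

theorem restr_eq_zero_iff (F : MvPolynomial σ ℂ) : Z.restr l F = 0 ↔ F ∈ Z.affineIdeal l :=
  Ideal.Quotient.eq_zero_iff_mem

theorem restr_surjective : Function.Surjective (Z.restr l) :=
  Ideal.Quotient.mkₐ_surjective ℂ _

theorem restr_of_mem {F : MvPolynomial σ ℂ} (hF : F ∈ Z.ideal) : Z.restr l F = 0 :=
  (Z.restr_eq_zero_iff F).2 (Ideal.mem_sup_left hF)

theorem restr_self : Z.restr l l = 1 := by
  rw [← sub_eq_zero, ← map_one (Z.restr l), ← map_sub, restr_eq_zero_iff]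
  exact Ideal.mem_sup_right (Ideal.mem_span_singleton_self _)

/-- If `l` is a nonzerodivisor modulo the ideal of `Z`, a form vanishes on `Z` as soon as it
vanishes on `Z ∩ {l = 1}`. -/
theorem mem_ideal_of_restr_eq_zero (hl : l.IsHomogeneous 1)
    (hreg : ∀ G, l * G ∈ Z.ideal → G ∈ Z.ideal) {t : ℕ} {F : MvPolynomial σ ℂ}
    (hF : F.IsHomogeneous t) (h : Z.restr l F = 0) : F ∈ Z.ideal := by
  rw [restr_eq_zero_iff] at h
  obtain ⟨G, hG, _, hH, hFG⟩ := Submodule.mem_sup.1 h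
  obtain ⟨H, rfl⟩ := Ideal.mem_span_singleton.1 hH
  have hcomp : ∀ j, homogeneousComponent j F = if j = t then F else 0 := fun j =>
    homogeneousComponent_of_mem hF
  -- The degree j part of F = G + (l - 1)H gives H_j ≡ l·H_{j-1} - F_j modulo the ideal. Beyond the
  -- degree of H this leaves a power of l times F in the ideal.
  have key : ∀ j, homogeneousComponent j H + (if t ≤ j then l ^ (j - t) * F else 0) ∈ Z.ideal := by
    intro j
    have hj := congrArg (homogeneousComponent j) hFG
    have hGj := Z.homogeneous G hG j
    rw [hcomp, sub_mul, one_mul, map_add, map_sub] at hj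
    induction j with
    | zero =>
      rw [homogeneousComponent_zero_mul hl] at hj
      convert hGj using 1
      rcases Nat.eq_zero_or_pos t with rfl | ht
      · simp only [le_refl, if_true, Nat.sub_zero, pow_zero, one_mul] at hj ⊢
        rw [← hj]; ring
      · rw [if_neg (by omega)] at hj
        rw [if_neg (by omega)]
        linear_combination -hj
    | succ j ih =>
      have ih' := ih (by rw [← hcomp, ← hFG]; simp [sub_mul]) (Z.homogeneous G hG j)
      rw [homogeneousComponent_succ_mul hl] at hj
      have := add_mem hGj (Z.ideal.mul_mem_left l ih')
      convert this using 1
      rcases lt_trichotomy t (j + 1) with h1 | h1 | h1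
      · rw [if_neg (by omega)] at hj
        rw [if_pos (by omega), if_pos (by omega), show j + 1 - t = (j - t) + 1 by omega]
        linear_combination -hj
      · rw [if_pos (by omega)] at hj
        rw [if_pos (by omega), if_neg (by omega), h1]
        simp only [Nat.sub_self, pow_zero, one_mul]
        linear_combination -hj
      · rw [if_neg (by omega)] at hj
        rw [if_neg (by omega), if_neg (by omega)]
        linear_combination -hj
  have hpow : ∀ m, l ^ m * F ∈ Z.ideal → F ∈ Z.ideal := by
    intro m
    induction m with
    | zero => simp
    | succ m ih => exact fun hm => ih (hreg _ (by rwa [pow_succ', mul_assoc] at hm))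
  have := key (t + (H.totalDegree + 1))
  rw [homogeneousComponent_eq_zero _ _ (by omega), if_pos (by omega), zero_add] at this
  exact hpow _ this

/-- Powers of l restrict to 1, so they can homogenize F without changing its restriction. -/
theorem exists_homogeneous_restr_eq (hl : l.IsHomogeneous 1) (F : MvPolynomial σ ℂ) {t : ℕ}
    (ht : F.totalDegree ≤ t) : ∃ G, G.IsHomogeneous t ∧ Z.restr l G = Z.restr l F := by
  refine ⟨∑ i ∈ Finset.range (F.totalDegree + 1), l ^ (t - i) * homogeneousComponent i F, ?_, ?_⟩
  · refine IsHomogeneous.sum _ _ _ fun i hi => ?_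
    have := Finset.mem_range.1 hi
    convert (hl.pow (t - i)).mul (homogeneousComponent_isHomogeneous i F) using 1
    omega
  · conv_rhs => rw [← sum_homogeneousComponent F]
    simp [map_sum, restr_self]

theorem finrank_map_restr_le [Finite σ] (t : ℕ) :
    Module.finrank ℂ ((homogeneousSubmodule σ ℂ t).map (Z.restr l).toLinearMap) ≤
      Z.hilbertFunction t := by
  have : Module.Finite ℂ (homogeneousSubmodule σ ℂ t) :=
    Module.Finite.iff_fg.2 (homogeneousSubmodule_fg σ ℂ t)
  let f : homogeneousSubmodule σ ℂ t →ₗ[ℂ] Z.AffineRing l :=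
    (Z.restr l).toLinearMap ∘ₗ (homogeneousSubmodule σ ℂ t).subtype
  let f' := ((Z.ideal.restrictScalars ℂ).submoduleOf (homogeneousSubmodule σ ℂ t)).liftQ f
    fun F hF => LinearMap.mem_ker.2 (Z.restr_of_mem hF)
  have hr : (homogeneousSubmodule σ ℂ t).map (Z.restr l).toLinearMap = LinearMap.range f' := by
    rw [Submodule.range_liftQ, LinearMap.range_comp, Submodule.range_subtype]
  rw [hr]
  exact LinearMap.finrank_range_le f'

/-- A finite independent family lifts to forms of one common large degree, where the Hilbert
function equals k. -/
theorem rank_affineRing_le [Finite σ] (hl : l.IsHomogeneous 1) {k : ℕ}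
    (hZ : Z.IsZeroDimOfDegree k) : Module.rank ℂ (Z.AffineRing l) ≤ k := by
  obtain ⟨t₀, ht₀⟩ := eventually_atTop.1 hZ
  refine rank_le fun s hs => ?_
  choose F hF using Z.restr_surjective (l := l)
  set t := max t₀ (s.sup fun a => (F a).totalDegree) with ht
  set V := (homogeneousSubmodule σ ℂ t).map (Z.restr l).toLinearMap with hV
  have : Module.Finite ℂ V :=
    Module.Finite.iff_fg.2 ((homogeneousSubmodule_fg σ ℂ t).map _)
  have hmem : ∀ a : s, a.1 ∈ V := fun a => by
    obtain ⟨G, hG, hGF⟩ := Z.exists_homogeneous_restr_eq hl (F a.1) (t := t)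
      ((Finset.le_sup (f := fun a => (F a).totalDegree) a.2).trans (le_max_right _ _))
    exact ⟨G, hG, by rw [AlgHom.toLinearMap_apply, hGF, hF]⟩
  have hli : LinearIndependent ℂ (fun a : s => (⟨a.1, hmem a⟩ : V)) :=
    LinearIndependent.of_comp V.subtype hs
  have := hli.fintype_card_le_finrank
  rw [Fintype.card_coe] at this
  exact this.trans ((Z.finrank_map_restr_le t).trans (ht₀ t (le_max_left _ _)).le)

/-- A functional killing 1 and the square of the maximal ideal at v is a point derivation, so the
chain rule applies. This links cotangent spaces of the ring to tangent vectors. -/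
theorem apply_restr_eq_sum_pderiv [Fintype σ] {v : σ → ℂ} {ε : Z.AffineRing l →ₐ[ℂ] ℂ}
    (hv : ∀ F, ε (Z.restr l F) = eval v F) {θ : Z.AffineRing l →ₗ[ℂ] ℂ} (h1 : θ 1 = 0)
    (hθ : ∀ a b, ε a = 0 → ε b = 0 → θ (a * b) = 0) (F : MvPolynomial σ ℂ) :
    θ (Z.restr l F) = ∑ i, eval v (pderiv i F) * θ (Z.restr l (X i)) := by
  classical
  have hz : ∀ z, θ (algebraMap ℂ _ z) = 0 := fun z => by
    rw [Algebra.algebraMap_eq_smul_one, map_smul, h1, smul_zero]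
  have leib : ∀ a b, θ (a * b) = ε a * θ b + ε b * θ a := by
    intro a b
    have h := hθ (a - algebraMap ℂ _ (ε a)) (b - algebraMap ℂ _ (ε b)) (by simp) (by simp)
    have e : (a - algebraMap ℂ (Z.AffineRing l) (ε a)) * (b - algebraMap ℂ _ (ε b)) =
        a * b - ε a • b - ε b • a + algebraMap ℂ _ (ε a * ε b) := by
      rw [Algebra.smul_def, Algebra.smul_def, map_mul]; ring
    rw [e, map_add, map_sub, map_sub, map_smul, map_smul, hz, smul_eq_mul, smul_eq_mul] at h
    linear_combination h
  induction F using MvPolynomial.induction_on with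
  | C z =>
    rw [← algebraMap_eq, AlgHom.commutes, hz]
    simp
  | add p q hp hq =>
    simp [hp, hq, add_mul, Finset.sum_add_distrib]
  | mul_X p i hp =>
    rw [map_mul, leib, hv, hv, hp]
    simp only [Derivation.leibniz, map_add, smul_eq_mul, map_mul, eval_X, add_mul,
      Finset.sum_add_distrib, pderiv_X, Finset.mul_sum]
    congr 1
    · rw [Finset.sum_eq_single i]
      · simp
      · intro j _ hj; simp [hj.symm]
      · simp
    · simp [mul_assoc]

/-- The cotangent spaces of a curvilinear scheme have dimension at most one. -/
theorem IsCurvilinear.exists_le_span_sup_sq [Fintype σ] {Z : ProjSubscheme σ}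
    (hZ : Z.IsCurvilinear) (hl : l.IsHomogeneous 1) [Module.Finite ℂ (Z.AffineRing l)]
    (m : Ideal (Z.AffineRing l)) (hm : m.IsMaximal) :
    ∃ π ∈ m, m ≤ Ideal.span {π} ⊔ m ^ 2 := by
  obtain ⟨ε, hε⟩ := exists_algHom_ker_eq m
  set v : σ → ℂ := fun i => ε (Z.restr l (X i)) with hvdef
  have hv : ∀ F, ε (Z.restr l F) = eval v F := fun F => by
    have : ε.comp (Z.restr l) = MvPolynomial.aeval v := MvPolynomial.algHom_ext fun i => by
      simp [hvdef]
    simpa [MvPolynomial.coe_aeval_eq_eval] using congrArg (fun f => f F) this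
  have hvl : eval v l = 1 := by rw [← hv, restr_self, map_one]
  have hpt : Z.HasPoint v := by
    refine ⟨fun h0 => ?_, fun F hF => by rw [← hv, Z.restr_of_mem hF, map_zero]⟩
    have hl0 : constantCoeff l = 0 := hl.coeff_eq_zero (by simp)
    rw [h0, eval_zero, hl0] at hvl
    exact zero_ne_one hvl
  have htan := hZ v hpt
  obtain ⟨x₀, hx₀⟩ := finrank_le_one_iff.1 htan
  have hmem : ∀ θ : Z.AffineRing l →ₗ[ℂ] ℂ, θ 1 = 0 → (∀ a b, ε a = 0 → ε b = 0 → θ (a * b) = 0) →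
      (Submodule.span ℂ {v}).mkQ (fun i => θ (Z.restr l (X i))) ∈ Z.tangentSpace v := by
    intro θ h1 h2
    refine Submodule.mem_map_of_mem ?_
    simp only [Submodule.mem_iInf, LinearMap.mem_ker]
    intro F hF
    have := Z.apply_restr_eq_sum_pderiv hv h1 h2 F
    rw [Z.restr_of_mem hF, map_zero] at this
    simpa using this.symm
  have hinj : ∀ θ : Z.AffineRing l →ₗ[ℂ] ℂ, θ 1 = 0 → (∀ a b, ε a = 0 → ε b = 0 → θ (a * b) = 0) →
      (Submodule.span ℂ {v}).mkQ (fun i => θ (Z.restr l (X i))) = 0 → θ = 0 := by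
    intro θ h1 h2 h3
    rw [Submodule.mkQ_apply, Submodule.Quotient.mk_eq_zero, Submodule.mem_span_singleton] at h3
    obtain ⟨z, hz⟩ := h3
    have hz' : ∀ i, θ (Z.restr l (X i)) = z * v i := fun i => (congrFun hz i).symm
    -- A derivation with vector z·v takes l, which restricts to 1, to 0; by Euler's identity it also
    -- takes l to z·l(v) = z.
    have hl1 := Z.apply_restr_eq_sum_pderiv hv h1 h2 l
    have euler := congrArg (eval v) hl.sum_X_mul_pderiv
    rw [restr_self, h1] at hl1
    simp only [map_sum, map_mul, eval_X, one_smul, hvl] at euler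
    have hz0 : z = 0 := by
      simp_rw [hz'] at hl1
      have : ∑ i, eval v (pderiv i l) * (z * v i) = z * ∑ i, v i * eval v (pderiv i l) := by
        rw [Finset.mul_sum]
        exact Finset.sum_congr rfl fun i _ => by ring
      rw [this, euler, mul_one] at hl1
      exact hl1.symm
    ext a
    obtain ⟨F, rfl⟩ := Z.restr_surjective a
    rw [Z.apply_restr_eq_sum_pderiv hv h1 h2]
    simp [hz', hz0]
  have hsep : ∀ (J : Ideal (Z.AffineRing l)) (p : Z.AffineRing l), m ^ 2 ≤ J → J ≤ m → p ∈ m →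
      p ∉ J → ∃ θ : Z.AffineRing l →ₗ[ℂ] ℂ, θ 1 = 0 ∧
        (∀ a b, ε a = 0 → ε b = 0 → θ (a * b) = 0) ∧ (∀ a ∈ J, θ a = 0) ∧ θ p ≠ 0 := by
    intro J p hJ hJm hp hpJ
    have hnot : p ∉ Submodule.span ℂ {1} ⊔ J.restrictScalars ℂ := by
      intro h
      obtain ⟨_, h1, b, hb, hab⟩ := Submodule.mem_sup.1 h
      obtain ⟨z, rfl⟩ := Submodule.mem_span_singleton.1 h1
      have hεb := (hε b).2 (hJm hb)
      have := congrArg ε hab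
      rw [map_add, map_smul, map_one, hεb, (hε p).2 hp] at this
      have hz : z = 0 := by simpa using this
      rw [hz, zero_smul, zero_add] at hab
      exact hpJ (hab ▸ hb)
    obtain ⟨θ, hθp, hθ⟩ := Submodule.exists_le_ker_of_notMem hnot
    refine ⟨θ, hθ (Submodule.mem_sup_left (Submodule.mem_span_singleton_self _)), ?_, ?_, hθp⟩
    · intro a b ha hb
      refine hθ (Submodule.mem_sup_right (hJ ?_))
      rw [sq]
      exact Ideal.mul_mem_mul ((hε a).1 ha) ((hε b).1 hb)
    · exact fun a ha => hθ (Submodule.mem_sup_right ha)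
  by_cases hle : m ≤ m ^ 2
  · exact ⟨0, m.zero_mem, hle.trans le_sup_right⟩
  obtain ⟨π, hπ, hπ2⟩ := SetLike.not_le_iff_exists.1 hle
  refine ⟨π, hπ, fun p hp => ?_⟩
  by_contra hpJ
  -- If π and m² do not generate m, then θ₁ with θ₁(π) ≠ 0 and a nonzero θ₂ with θ₂(π) = 0 are
  -- independent derivations, too many for a tangent space of dimension at most one.
  obtain ⟨θ₁, h11, h12, -, h1π⟩ := hsep (m ^ 2) π le_rfl (Ideal.pow_le_self two_ne_zero) hπ hπ2
  obtain ⟨θ₂, h21, h22, h2J, h2p⟩ := hsep (Ideal.span {π} ⊔ m ^ 2) p le_sup_right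
    (sup_le ((Ideal.span_singleton_le_iff_mem _).2 hπ) (Ideal.pow_le_self two_ne_zero)) hp hpJ
  obtain ⟨c₁, hc₁⟩ := hx₀ ⟨_, hmem θ₁ h11 h12⟩
  obtain ⟨c₂, hc₂⟩ := hx₀ ⟨_, hmem θ₂ h21 h22⟩
  have hc₁' := congrArg Subtype.val hc₁
  have hc₂' := congrArg Subtype.val hc₂
  simp only [Submodule.coe_smul] at hc₁' hc₂'
  have h0 : c₂ • θ₁ - c₁ • θ₂ = 0 := by
    apply hinj
    · simp [h11, h21]
    · intro a b ha hb
      simp [h12 a b ha hb, h22 a b ha hb]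
    · have : (fun i => (c₂ • θ₁ - c₁ • θ₂) (Z.restr l (X i))) =
          c₂ • (fun i => θ₁ (Z.restr l (X i))) - c₁ • (fun i => θ₂ (Z.restr l (X i))) := by
        ext i; simp
      rw [this, map_sub, map_smul, map_smul, ← hc₁', ← hc₂', smul_smul, smul_smul, mul_comm,
        sub_self]
  have hc20 : c₂ = 0 := by
    have := congrArg (fun f => f π) h0
    simpa [h2J π (Ideal.mem_sup_left (Ideal.mem_span_singleton_self π)), h1π] using this
  rw [hc20, zero_smul] at hc₂'
  exact h2p (by rw [hinj θ₂ h21 h22 hc₂'.symm]; rfl)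

end ProjSubscheme

end Affine

/-! ### The Veronese variety and the bound. -/

section Veronese

variable {n d : ℕ}

theorem Expo.degree_eq (a : Expo n d) : a.1.degree = d := by
  have := (Finset.mem_finsuppAntidiag.1 a.2).1
  rwa [Finsupp.degree_eq_sum]

theorem Expo.sum_eq (a : Expo n d) : ∑ i, a.1 i = d :=
  (Finset.mem_finsuppAntidiag.1 a.2).1

/-- The exponent of a monomial of degree `d`. -/
def Expo.ofDegree (a : Fin (n + 1) →₀ ℕ) (ha : a.degree = d) : Expo n d :=
  ⟨a, Finset.mem_finsuppAntidiag.2 ⟨by rwa [Finsupp.degree_eq_sum] at ha, Finset.subset_univ _⟩⟩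

theorem multinomial_ne_zero (a : Fin (n + 1) →₀ ℕ) : (a.multinomial : ℂ) ≠ 0 := by
  rw [Finsupp.multinomial_eq]
  exact_mod_cast (Nat.multinomial_pos _ _).ne'

theorem form_eq_sum_monomial {G : MvPolynomial (Fin (n + 1)) ℂ} (hG : G.IsHomogeneous d) :
    G = ∑ a : Expo n d, monomial a.1 (coeff a.1 G) := by
  classical
  ext m
  rw [coeff_sum]
  simp only [coeff_monomial]
  by_cases hm : m.degree = d
  · rw [Finset.sum_eq_single (Expo.ofDegree m hm)]
    · simp [Expo.ofDegree]
    · intro a _ ha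
      rw [if_neg]
      exact fun h => ha (Subtype.ext h)
    · simp
  · rw [hG.coeff_eq_zero hm, Finset.sum_eq_zero]
    intro a _
    rw [if_neg]
    rintro rfl
    exact hm a.degree_eq

theorem eval_form {G : MvPolynomial (Fin (n + 1)) ℂ} (hG : G.IsHomogeneous d)
    (u : Fin (n + 1) → ℂ) :
    eval u G = ∑ a : Expo n d, coeff a.1 G * ∏ i, u i ^ a.1 i := by
  conv_lhs => rw [form_eq_sum_monomial hG]
  rw [map_sum]
  refine Finset.sum_congr rfl fun a _ => ?_
  rw [eval_monomial, Finsupp.prod_fintype _ _ (fun i => pow_zero _)]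

theorem eval_form_mul {G : MvPolynomial (Fin (n + 1)) ℂ} (hG : G.IsHomogeneous d)
    (u : Fin (n + 1) → ℂ) (z : ℂ) : eval (fun i => u i * z) G = z ^ d * eval u G := by
  rw [eval_form hG, eval_form hG, Finset.mul_sum]
  refine Finset.sum_congr rfl fun a _ => ?_
  simp_rw [mul_pow]
  rw [Finset.prod_mul_distrib, Finset.prod_pow_eq_pow_sum, a.sum_eq]
  ring

/-- The linear form with coefficients `c`. -/
def linForm (c : Fin (n + 1) → ℂ) : MvPolynomial (Fin (n + 1)) ℂ := ∑ i, c i • X i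

theorem linForm_isHomogeneous (c : Fin (n + 1) → ℂ) : (linForm c).IsHomogeneous 1 := by
  refine IsHomogeneous.sum _ _ _ fun i _ => ?_
  rw [smul_eq_C_mul]
  exact isHomogeneous_C_mul_X _ _

theorem linForm_pow_isHomogeneous (c : Fin (n + 1) → ℂ) (d : ℕ) :
    (linForm c ^ d).IsHomogeneous d := by
  simpa using (linForm_isHomogeneous c).pow d

theorem exists_eq_linForm {L : MvPolynomial (Fin (n + 1)) ℂ} (hL : L.IsHomogeneous 1) :
    ∃ c, L = linForm c := by
  have h : L ∈ homogeneousSubmodule (Fin (n + 1)) ℂ 1 := hL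
  rw [homogeneousSubmodule_one_eq_span_X, Submodule.mem_span_range_iff_exists_fun] at h
  obtain ⟨c, hc⟩ := h
  exact ⟨c, hc.symm⟩

theorem eval_linForm (c u : Fin (n + 1) → ℂ) : eval u (linForm c) = ∑ i, c i * u i := by
  simp [linForm, smul_eval]

theorem coeff_linForm_pow (c : Fin (n + 1) → ℂ) (a : Expo n d) :
    coeff a.1 (linForm c ^ d) = a.1.multinomial * ∏ i, c i ^ a.1 i := by
  rw [linForm, coeff_linearCombination_X_pow_of_fintype,
    Finsupp.prod_fintype _ _ (fun i => pow_zero _), if_pos]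
  rw [Finsupp.sum_fintype _ _ (fun _ => rfl), a.sum_eq]

/-- The `d`-th power of the linear form with coefficients `u`, in coordinates. -/
def veronesePoint (n d : ℕ) (u : Fin (n + 1) → ℂ) : Expo n d → ℂ :=
  fun a => a.1.multinomial * ∏ i, u i ^ a.1 i

theorem mem_ideal_of_eval_veronesePoint {Z : ProjSubscheme (Expo n d)} (hZ : InVeronese Z)
    {F : MvPolynomial (Expo n d) ℂ} (hF : ∀ u, eval (veronesePoint n d u) F = 0) :
    F ∈ Z.ideal := by
  refine hZ (mem_vanishingIdeal_iff.2 ?_)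
  rintro v ⟨L, hL, rfl⟩
  obtain ⟨c, rfl⟩ := exists_eq_linForm hL
  have : coords n d (linForm c ^ d) = veronesePoint n d c := funext fun a => coeff_linForm_pow c a
  rw [this]
  exact hF c

/-- The linear form on the space of degree `d` forms that restricts to `G` on the Veronese
variety. -/
def veroneseLin (d : ℕ) (G : MvPolynomial (Fin (n + 1)) ℂ) : MvPolynomial (Expo n d) ℂ :=
  ∑ a : Expo n d, C (coeff a.1 G / a.1.multinomial) * X a

theorem veroneseLin_isHomogeneous (G : MvPolynomial (Fin (n + 1)) ℂ) :
    (veroneseLin d G).IsHomogeneous 1 :=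
  IsHomogeneous.sum _ _ _ fun _ _ => isHomogeneous_C_mul_X _ _

theorem eval_veroneseLin {G : MvPolynomial (Fin (n + 1)) ℂ} (hG : G.IsHomogeneous d)
    (u : Fin (n + 1) → ℂ) : eval (veronesePoint n d u) (veroneseLin d G) = eval u G := by
  rw [eval_form hG, veroneseLin, map_sum]
  refine Finset.sum_congr rfl fun a _ => ?_
  rw [map_mul, eval_C, eval_X, veronesePoint]
  have := multinomial_ne_zero a.1
  field_simp

theorem veroneseLin_linForm_pow (c : Fin (n + 1) → ℂ) :
    veroneseLin d (linForm c ^ d) = ∑ a : Expo n d, (∏ i, c i ^ a.1 i) • X a := by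
  refine Finset.sum_congr rfl fun a _ => ?_
  rw [coeff_linForm_pow, mul_div_cancel_left₀ _ (multinomial_ne_zero a.1), smul_eq_C_mul]

/-- On the Veronese variety the `d`-th power of each coordinate is a constant times a monomial in
the sections x_i^d. A prime containing all x_i^d therefore contains every coordinate. -/
theorem exists_veroneseLin_notMem (hd : 1 ≤ d) {Z : ProjSubscheme (Expo n d)} (hZ : InVeronese Z)
    (Q : Ideal (MvPolynomial (Expo n d) ℂ)) (hQ : Q.IsPrime) (hle : Z.ideal ≤ Q)
    (hX : ∃ a, X a ∉ Q) : ∃ c : Fin (n + 1) → ℂ, veroneseLin d (linForm c ^ d) ∉ Q := by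
  by_contra! hall
  obtain ⟨a, ha⟩ := hX
  set y : Fin (n + 1) → MvPolynomial (Expo n d) ℂ :=
    fun i => veroneseLin d (linForm (Pi.single i 1) ^ d) with hy
  have hmem : X a ^ d - C ((a.1.multinomial : ℂ) ^ d) * ∏ i, y i ^ a.1 i ∈ Q := by
    refine hle (mem_ideal_of_eval_veronesePoint hZ fun u => ?_)
    have hyi : ∀ i, eval (veronesePoint n d u) (y i) = u i ^ d := fun i => by
      rw [hy, eval_veroneseLin (linForm_pow_isHomogeneous _ _), map_pow, eval_linForm]
      simp [Pi.single_apply]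
    simp only [map_sub, map_mul, map_pow, eval_X, eval_C, map_prod, hyi, veronesePoint]
    rw [mul_pow, ← Finset.prod_pow]
    simp_rw [← pow_mul, mul_comm d]
    exact sub_self _
  obtain ⟨i, hi⟩ : ∃ i, a.1 i ≠ 0 := by
    by_contra! h
    have := a.sum_eq
    simp [h] at this
    omega
  have hprod : ∏ i, y i ^ a.1 i ∈ Q :=
    Ideal.prod_mem _ (Finset.mem_univ i)
      (Ideal.pow_mem_of_mem _ (hall _) _ (Nat.pos_of_ne_zero hi))
  have := add_mem hmem (Q.mul_mem_left (C ((a.1.multinomial : ℂ) ^ d)) hprod)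
  rw [sub_add_cancel] at this
  exact ha (hQ.mem_of_pow_mem _ this)

/-- Some hyperplane section of `X_{n,d}` by the `d`-th power of a linear form avoids `Z`. -/
theorem exists_regular_veroneseLin (hd : 1 ≤ d) {Z : ProjSubscheme (Expo n d)}
    (hZ : InVeronese Z) : ∃ c : Fin (n + 1) → ℂ, ∀ G,
      veroneseLin d (linForm c ^ d) * G ∈ Z.ideal → G ∈ Z.ideal := by
  classical
  let T := MvPolynomial (Expo n d) ℂ
  -- Zero divisors modulo the ideal form the union of these finitely many primes. By saturation none
  -- contains all coordinates, so each excludes only the zeros c of a nonzero polynomial.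
  have hfin : (associatedPrimes T (T ⧸ Z.ideal)).Finite := associatedPrimes.finite T (T ⧸ Z.ideal)
  have hpoly : ∀ Q ∈ associatedPrimes T (T ⧸ Z.ideal),
      ∃ p : MvPolynomial (Fin (n + 1)) ℂ, p ≠ 0 ∧
        ∀ c, veroneseLin d (linForm c ^ d) ∈ Q → eval c p = 0 := by
    intro Q hQ
    obtain ⟨hQp, x, hx⟩ := isAssociatedPrime_iff.1 hQ
    obtain ⟨F, rfl⟩ := Ideal.Quotient.mk_surjective x
    have hmemQ : ∀ G : T, G ∈ Q ↔ G * F ∈ Z.ideal := fun G => by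
      rw [hx, Submodule.mem_colon_singleton, Submodule.mem_bot, ← Ideal.Quotient.eq_zero_iff_mem,
        map_mul]
      rfl
    have hle : Z.ideal ≤ Q := fun G hG => (hmemQ G).2 (Z.ideal.mul_mem_right F hG)
    have hX : ∃ a, X a ∉ Q := by
      by_contra! h
      have hF : F ∈ Z.ideal := Z.saturated F fun a => (hmemQ _).1 (h a)
      exact hQp.ne_top ((Ideal.eq_top_iff_one _).2 ((hmemQ 1).2 (by rwa [one_mul])))
    obtain ⟨c₀, hc₀⟩ := exists_veroneseLin_notMem hd hZ Q hQp hle hX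
    obtain ⟨θ, hθ0, hθ⟩ := Submodule.exists_le_ker_of_notMem (p := Q.restrictScalars ℂ) hc₀
    have hev : ∀ c, eval c (∑ a : Expo n d, monomial a.1 (θ (X a))) =
        θ (veroneseLin d (linForm c ^ d)) := fun c => by
      rw [veroneseLin_linForm_pow, map_sum, map_sum]
      refine Finset.sum_congr rfl fun a _ => ?_
      rw [eval_monomial, Finsupp.prod_fintype _ _ (fun i => pow_zero _), map_smul, smul_eq_mul,
        mul_comm]
    refine ⟨_, fun h0 => hθ0 ?_, fun c hc => (hev c).trans (hθ hc)⟩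
    rw [← hev, h0, map_zero]
  choose! p hp0 hp using hpoly
  have hne : ∏ Q ∈ hfin.toFinset, p Q ≠ 0 :=
    Finset.prod_ne_zero_iff.2 fun Q hQ => hp0 Q (hfin.mem_toFinset.1 hQ)
  obtain ⟨c, hc⟩ : ∃ c, eval c (∏ Q ∈ hfin.toFinset, p Q) ≠ 0 := by
    by_contra! h
    exact hne (MvPolynomial.funext fun c => by rw [h c, map_zero])
  refine ⟨c, fun G hG => ?_⟩
  by_contra hGn
  have hzd : veroneseLin d (linForm c ^ d) ∈ ⋃ Q ∈ associatedPrimes T (T ⧸ Z.ideal), (Q : Set T) := by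
    rw [biUnion_associatedPrimes_eq_zero_divisors]
    refine ⟨Ideal.Quotient.mk _ G, fun h => hGn (Ideal.Quotient.eq_zero_iff_mem.1 h), ?_⟩
    exact Ideal.Quotient.eq_zero_iff_mem.2 hG
  obtain ⟨Q, hQ, hmem⟩ := Set.mem_iUnion₂.1 hzd
  rw [map_prod, Finset.prod_ne_zero_iff] at hc
  exact hc Q (hfin.mem_toFinset.2 hQ) (hp Q hQ c hmem)

/-- With ℓ = `linForm c`, the relation G·(ℓ^d)^(d-1) = G(x_i·ℓ^(d-1)) holds on the Veronese variety,
and ℓ^d restricts to 1. So the x_i·ℓ^(d-1) serve as affine coordinates x_i/ℓ. -/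
theorem restr_veroneseLin (hd : 1 ≤ d) {Z : ProjSubscheme (Expo n d)} (hZ : InVeronese Z)
    (c : Fin (n + 1) → ℂ) {G : MvPolynomial (Fin (n + 1)) ℂ} (hG : G.IsHomogeneous d) :
    Z.restr (veroneseLin d (linForm c ^ d)) (veroneseLin d G) =
      aeval (fun i => Z.restr (veroneseLin d (linForm c ^ d))
        (veroneseLin d (X i * linForm c ^ (d - 1)))) G := by
  set l := veroneseLin d (linForm c ^ d) with hl
  set τ : Fin (n + 1) → MvPolynomial (Expo n d) ℂ :=
    fun i => veroneseLin d (X i * linForm c ^ (d - 1)) with hτ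
  have hhom : ∀ i, (X i * linForm c ^ (d - 1)).IsHomogeneous d := fun i => by
    have := (isHomogeneous_X ℂ i).mul (linForm_pow_isHomogeneous c (d - 1))
    rwa [Nat.add_sub_cancel' hd] at this
  have hmem : veroneseLin d G * l ^ (d - 1) - aeval τ G ∈ Z.ideal := by
    refine mem_ideal_of_eval_veronesePoint hZ fun u => ?_
    have h1 : eval (veronesePoint n d u) (aeval τ G) =
        eval (fun i => eval (veronesePoint n d u) (τ i)) G := by
      rw [← coe_aeval_eq_eval, ← coe_aeval_eq_eval]
      exact congrArg (fun f => f G) (comp_aeval τ (aeval (veronesePoint n d u)))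
    have h2 : (fun i => eval (veronesePoint n d u) (τ i)) =
        fun i => u i * (∑ j, c j * u j) ^ (d - 1) := by
      ext i
      rw [hτ, eval_veroneseLin (hhom i), map_mul, eval_X, map_pow, eval_linForm]
    rw [map_sub, h1, h2, eval_form_mul hG, map_mul, map_pow, eval_veroneseLin hG, hl,
      eval_veroneseLin (linForm_pow_isHomogeneous c d), map_pow, eval_linForm, ← pow_mul,
      ← pow_mul, mul_comm d]
    ring
  have := Z.restr_of_mem (l := l) hmem
  rw [map_sub, map_mul, map_pow, Z.restr_self, one_pow, mul_one, sub_eq_zero] at this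
  rw [this]
  exact congrArg (fun f => f G) (comp_aeval τ (Z.restr l))

/-- A form in the span of a curvilinear scheme of degree `k` comes from a functional on `ℂ[X]`
that vanishes on the multiples of a polynomial of degree at most `k`. -/
theorem exists_curve (hd : 1 ≤ d) {P : MvPolynomial (Fin (n + 1)) ℂ} {k : ℕ}
    (hk : k ∈ curvilinearLengths n d P) :
    ∃ (f : Fin (n + 1) → Polynomial ℂ) (Φ : Polynomial ℂ →ₗ[ℂ] ℂ) (g : Polynomial ℂ), g ≠ 0 ∧
      g.natDegree ≤ k ∧ (∀ q, Φ (g * q) = 0) ∧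
      ∀ a : Expo n d, coeff a.1 P = a.1.multinomial * Φ (∏ i, f i ^ a.1 i) := by
  obtain ⟨Z, hdeg, hcurv, hver, hspan⟩ := hk
  obtain ⟨c, hreg⟩ := exists_regular_veroneseLin hd hver
  set l := veroneseLin d (linForm c ^ d) with hl
  have hl1 : l.IsHomogeneous 1 := veroneseLin_isHomogeneous _
  have hrank := Z.rank_affineRing_le hl1 hdeg
  have hfin : Module.Finite ℂ (Z.AffineRing l) :=
    Module.rank_lt_aleph0_iff.1 (hrank.trans_lt (Cardinal.natCast_lt_aleph0))
  have hfr : Module.finrank ℂ (Z.AffineRing l) ≤ k := by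
    rw [← Module.finrank_eq_rank] at hrank
    exact_mod_cast hrank
  obtain ⟨s, hs⟩ := exists_aeval_surjective fun m hm => hcurv.exists_le_span_sup_sq hl1 m hm
  let E : (Expo n d → ℂ) →ₗ[ℂ] Z.AffineRing l :=
    Fintype.linearCombination ℂ fun a => Z.restr l (X a)
  let pf : Module.Dual ℂ (Expo n d → ℂ) := Fintype.linearCombination ℂ fun a => coeff a.1 P
  -- Linear forms that vanish on the chart vanish on Z, hence at P because [P] ∈ ⟨Z⟩. So evaluation
  -- at P factors through the affine ring.
  have hpf : pf ∈ (LinearMap.ker E).dualAnnihilator := by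
    rw [Submodule.mem_dualAnnihilator]
    intro z hz
    have hz' : Z.restr l (∑ a, z a • X a) = 0 := by
      simpa [E, Fintype.linearCombination_apply, map_sum] using hz
    have hh : (∑ a, z a • X a : MvPolynomial (Expo n d) ℂ).IsHomogeneous 1 := by
      refine IsHomogeneous.sum _ _ _ fun i _ => ?_
      rw [smul_eq_C_mul]
      exact isHomogeneous_C_mul_X _ _
    have := hspan _ (Z.mem_ideal_of_restr_eq_zero hl1 hreg hh hz') hh
    simpa [pf, Fintype.linearCombination_apply, smul_eval, coords] using this
  rw [← LinearMap.range_dualMap_eq_dualAnnihilator_ker] at hpf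
  obtain ⟨φ, hφ⟩ := hpf
  have hφa : ∀ a : Expo n d, φ (Z.restr l (X a)) = coeff a.1 P := fun a => by
    classical
    have := congrArg (fun f => f (Pi.single a 1)) hφ
    simpa [E, pf, Fintype.linearCombination_apply_single] using this
  choose f hf using fun i => hs (Z.restr l (veroneseLin d (X i * linForm c ^ (d - 1))))
  refine ⟨f, φ ∘ₗ (Polynomial.aeval s).toLinearMap, minpoly ℂ s,
    minpoly.ne_zero (Algebra.IsIntegral.isIntegral s), (minpoly.natDegree_le s).trans hfr,
    fun q => by simp, fun a => ?_⟩
  have hX : veroneseLin d (monomial a.1 (a.1.multinomial : ℂ)) = X a := by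
    classical
    rw [veroneseLin, Finset.sum_eq_single a]
    · rw [coeff_monomial, if_pos rfl, div_self (multinomial_ne_zero a.1), C_1, one_mul]
    · intro b _ hb
      rw [coeff_monomial, if_neg fun h => hb (Subtype.ext h.symm), zero_div, C_0, zero_mul]
    · simp
  have := restr_veroneseLin hd hver c (isHomogeneous_monomial (a.1.multinomial : ℂ) a.degree_eq)
  rw [hX, aeval_monomial, Finsupp.prod_fintype _ _ (fun i => pow_zero _), ← hl] at this
  rw [← hφa, this]
  simp_rw [← hf]
  rw [← Algebra.smul_def, map_smul, smul_eq_mul, LinearMap.comp_apply, AlgHom.toLinearMap_apply,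
    map_prod (Polynomial.aeval (R := ℂ) s)]
  simp_rw [map_pow]

/-- The bound on the rank by the degree of a curvilinear scheme. -/
theorem exists_mem_powerSumLengths_le (hd : 1 ≤ d) {P : MvPolynomial (Fin (n + 1)) ℂ}
    (hP : P.IsHomogeneous d) (hP0 : P ≠ 0) {k : ℕ} (hk : k ∈ curvilinearLengths n d P) :
    1 ≤ k ∧ ∃ r ∈ powerSumLengths n d P, r ≤ (k - 1) * (d - 1) + 1 := by
  obtain ⟨f, Φ, g, hg0, hgk, hΦg, hcoeff⟩ := exists_curve hd hk
  let I : Ideal (Polynomial ℂ) :=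
    { carrier := {p | ∀ q, Φ (p * q) = 0}
      add_mem' := fun {p p'} hp hp' q => by rw [add_mul, map_add, hp, hp', add_zero]
      zero_mem' := fun q => by rw [zero_mul, map_zero]
      smul_mem' := fun c p hp q => by
        rw [smul_eq_mul, mul_comm c, mul_assoc]
        exact hp _ }
  set g' : Polynomial ℂ := normalize (Submodule.IsPrincipal.generator I) with hg'
  have hdvd : ∀ p, p ∈ I ↔ g' ∣ p := fun p => by
    rw [hg', normalize_dvd_iff]
    exact Submodule.IsPrincipal.mem_iff_generator_dvd I
  have hg'g : g' ∣ g := (hdvd g).1 hΦg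
  have hg'0 : g' ≠ 0 := ne_zero_of_dvd_ne_zero hg0 hg'g
  have hmonic : g'.Monic := Polynomial.monic_normalize fun h => hg'0 (by rw [hg', h, normalize_zero])
  have hΦ' : ∀ q, Φ (g' * q) = 0 := (hdvd g').2 dvd_rfl
  have hg'k : g'.natDegree ≤ k := (Polynomial.natDegree_le_of_dvd hg'g hg0).trans hgk
  have hk' : 1 ≤ g'.natDegree := by
    by_contra h
    have h1 : g' = 1 := hmonic.natDegree_eq_zero.1 (by omega)
    refine hP0 ?_
    rw [form_eq_sum_monomial hP]
    refine Finset.sum_eq_zero fun a _ => ?_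
    have := hΦ' (∏ i, f i ^ a.1 i)
    rw [h1, one_mul] at this
    rw [hcoeff, this, mul_zero, monomial_zero]
  refine ⟨hk'.trans hg'k, ?_⟩
  -- For d = 1 the number of nodes would be 1, possibly below the degree of g', which
  -- `exists_quadrature` excludes.
  rcases eq_or_lt_of_le hd with rfl | hd2
  · exact ⟨1, ⟨fun _ => P, fun _ => hP, by simp⟩, by simp⟩
  obtain ⟨K, hK⟩ : ∃ K, g'.natDegree = K + 1 := ⟨_, (Nat.sub_add_cancel hk').symm⟩
  obtain ⟨δ, rfl⟩ : ∃ δ, d = δ + 2 := ⟨d - 2, by omega⟩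
  obtain ⟨α, w, hquad⟩ := exists_quadrature Φ hmonic hΦ' (fun p hp => (hdvd p).1 hp) hk'
    (D := K * (δ + 2)) (e := K * (δ + 1) + 1) (by rw [hK]; nlinarith) (by rw [hK]; ring)
  -- Reduction modulo g' bounds the degree of each factor by K, hence that of the products by D =
  -- Kd.
  have hred : ∀ a : Fin (n + 1) →₀ ℕ, Φ (∏ i, f i ^ a i) = Φ (∏ i, (f i %ₘ g') ^ a i) := by
    intro a
    rw [← sub_eq_zero, ← map_sub]
    have : g' ∣ ∏ i, f i ^ a i - ∏ i, (f i %ₘ g') ^ a i := by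
      rw [← Ideal.mem_span_singleton, ← Ideal.Quotient.eq_zero_iff_mem, map_sub, sub_eq_zero,
        map_prod, map_prod]
      refine Finset.prod_congr rfl fun i _ => ?_
      rw [map_pow, map_pow]
      congr 1
      rw [Ideal.Quotient.mk_eq_mk_iff_sub_mem, Ideal.mem_span_singleton]
      refine ⟨f i /ₘ g', ?_⟩
      linear_combination -Polynomial.modByMonic_add_div (f i) g'
    obtain ⟨q, hq⟩ := this
    rw [hq, hΦ']
  have hdeg : ∀ a : Expo n (δ + 2), (∏ i, (f i %ₘ g') ^ a.1 i).natDegree ≤ K * (δ + 2) := by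
    intro a
    refine (Polynomial.natDegree_prod_le _ _).trans ?_
    have hsum : K * (δ + 2) = ∑ i, K * a.1 i := by rw [← Finset.mul_sum, a.sum_eq]
    rw [hsum]
    refine Finset.sum_le_sum fun i _ => Polynomial.natDegree_pow_le.trans ?_
    rw [mul_comm]
    refine Nat.mul_le_mul_right _ ?_
    have := Polynomial.natDegree_modByMonic_lt (f i) hmonic fun h => by simp [h] at hk'
    omega
  -- The `d`-th roots of the weights are absorbed into the linear forms.
  choose z hz using fun j => IsAlgClosed.exists_pow_nat_eq (w j) (n := δ + 2) (by omega)
  refine ⟨K * (δ + 1) + 1, ⟨fun j => linForm fun i => z j * (f i %ₘ g').eval (α j),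
    fun j => linForm_isHomogeneous _, ?_⟩, ?_⟩
  · rw [form_eq_sum_monomial hP, form_eq_sum_monomial (IsHomogeneous.sum Finset.univ _ (δ + 2)
      fun j _ => linForm_pow_isHomogeneous _ _)]
    refine Finset.sum_congr rfl fun a _ => ?_
    congr 1
    rw [hcoeff, hred, hquad _ (hdeg a), coeff_sum, Finset.mul_sum]
    refine Finset.sum_congr rfl fun j _ => ?_
    rw [coeff_linForm_pow, Polynomial.eval_prod]
    simp_rw [mul_pow, Polynomial.eval_pow]
    rw [Finset.prod_mul_distrib, Finset.prod_pow_eq_pow_sum, a.sum_eq, hz]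
  · have : K ≤ k - 1 := by omega
    simpa using Nat.mul_le_mul_right (δ + 1) this

end Veronese

/-! ### Curvilinear schemes on monomial curves. -/

section MonomialCurve

variable {σ : Type*}

/-- The homomorphism dual to the cone over the monomial curve `s ↦ (μ a * s ^ wt a)_a`. -/
def coneHom (μ : σ → ℂ) (wt : σ → ℕ) :
    MvPolynomial σ ℂ →ₐ[ℂ] Polynomial (Polynomial ℂ) :=
  aeval fun a => Polynomial.X * Polynomial.C (Polynomial.C (μ a) * Polynomial.X ^ wt a)

/-- The homomorphism dual to the monomial curve `s ↦ (μ a * s ^ wt a)_a`. -/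
def curveHom (μ : σ → ℂ) (wt : σ → ℕ) : MvPolynomial σ ℂ →ₐ[ℂ] Polynomial ℂ :=
  aeval fun a => Polynomial.C (μ a) * Polynomial.X ^ wt a

variable (μ : σ → ℂ) (wt : σ → ℕ)

theorem curveHom_X (a : σ) :
    curveHom μ wt (X a) = Polynomial.C (μ a) * Polynomial.X ^ wt a := aeval_X _ _

/-- The outer variable records the degree, which makes `curveIdeal` homogeneous. -/
theorem coeff_coneHom (F : MvPolynomial σ ℂ) (t : ℕ) :
    (coneHom μ wt F).coeff t = curveHom μ wt (homogeneousComponent t F) := by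
  classical
  induction F using MvPolynomial.induction_on' with
  | monomial m r =>
    have h1 : coneHom μ wt (monomial m r) =
        Polynomial.C (curveHom μ wt (monomial m r)) * Polynomial.X ^ m.degree := by
      rw [coneHom, curveHom, aeval_monomial, aeval_monomial]
      rw [Finsupp.degree_apply, ← Finset.prod_pow_eq_pow_sum]
      simp only [Finsupp.prod, mul_pow, map_mul, map_prod, map_pow, Finset.prod_mul_distrib]
      rw [show algebraMap ℂ (Polynomial (Polynomial ℂ)) r =
        Polynomial.C (algebraMap ℂ (Polynomial ℂ) r) from rfl]
      ring
    rw [h1, Polynomial.coeff_C_mul_X_pow,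
      homogeneousComponent_of_mem (isHomogeneous_monomial r rfl : monomial m r ∈ _)]
    split_ifs <;> simp
  | add p q hp hq => rw [map_add, Polynomial.coeff_add, hp, hq, map_add, map_add]

/-- The subscheme of length `k` of the monomial curve, supported at `s = 0`. -/
def curveIdeal (k : ℕ) : Ideal (MvPolynomial σ ℂ) :=
  ((Ideal.span {(Polynomial.X : Polynomial ℂ) ^ k}).map Polynomial.C).comap (coneHom μ wt)

variable {μ wt} {k : ℕ}

theorem mem_curveIdeal_iff {F : MvPolynomial σ ℂ} : F ∈ curveIdeal μ wt k ↔
    ∀ t, Polynomial.X ^ k ∣ curveHom μ wt (homogeneousComponent t F) := by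
  rw [curveIdeal, Ideal.mem_comap, Ideal.mem_map_C_iff]
  simp_rw [← coeff_coneHom, Ideal.mem_span_singleton]

theorem IsHomogeneous.mem_curveIdeal_iff {F : MvPolynomial σ ℂ} {t : ℕ} (hF : F.IsHomogeneous t) :
    F ∈ curveIdeal μ wt k ↔ Polynomial.X ^ k ∣ curveHom μ wt F := by
  rw [CurvilinearRank.mem_curveIdeal_iff]
  refine ⟨fun h => ?_, fun h t' => ?_⟩
  · have := h t
    rwa [homogeneousComponent_eq_self hF] at this
  · rw [homogeneousComponent_of_mem hF]
    split_ifs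
    · exact h
    · simp

/-- The monomial curve scheme. -/
def curveScheme (k : ℕ) (hμ : ∀ a, μ a ≠ 0) (h0 : ∃ a, wt a = 0) : ProjSubscheme σ where
  ideal := curveIdeal μ wt k
  homogeneous F hF t :=
    (IsHomogeneous.mem_curveIdeal_iff (homogeneousComponent_isHomogeneous t F)).2
      (mem_curveIdeal_iff.1 hF t)
  saturated F hF := by
    -- A coordinate of weight 0 pulls back to a nonzero constant and can be cancelled.
    obtain ⟨a, ha⟩ := h0
    rw [mem_curveIdeal_iff]
    intro t
    have := mem_curveIdeal_iff.1 (hF a) (t + 1)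
    rw [homogeneousComponent_succ_mul (isHomogeneous_X ℂ a), map_mul, curveHom_X, ha, pow_zero,
      mul_one] at this
    exact (IsUnit.dvd_mul_left (Polynomial.isUnit_C.2 (IsUnit.mk0 _ (hμ a)))).1 this

variable (hμ : ∀ a, μ a ≠ 0) (h0 : ∃ a, wt a = 0)

/-- In degree t ≥ k, products of coordinates of weights 0 and 1 realize every s^j with j < k, so the
quotient is ℂ[s]/(s^k). -/
theorem curveScheme_isZeroDimOfDegree (h1 : 1 < k → ∃ a, wt a = 1) :
    (curveScheme k hμ h0).IsZeroDimOfDegree k := by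
  classical
  refine eventually_atTop.2 ⟨k, fun t ht => ?_⟩
  let ψ : homogeneousSubmodule σ ℂ t →ₗ[ℂ] (Fin k → ℂ) :=
    (LinearMap.pi fun j : Fin k => Polynomial.lcoeff ℂ (j : ℕ)) ∘ₗ (curveHom μ wt).toLinearMap ∘ₗ
      (homogeneousSubmodule σ ℂ t).subtype
  have hker : (((curveScheme k hμ h0).ideal.restrictScalars ℂ).submoduleOf
      (homogeneousSubmodule σ ℂ t)) = LinearMap.ker ψ := by
    ext F
    have hF : F.1.IsHomogeneous t := F.2
    refine (IsHomogeneous.mem_curveIdeal_iff hF).trans ?_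
    rw [Polynomial.X_pow_dvd_iff, LinearMap.mem_ker]
    exact ⟨fun h => funext fun j => h j.1 j.2, fun h j hj => congrFun h ⟨j, hj⟩⟩
  have hsurj : LinearMap.range ψ = ⊤ := by
    rw [eq_top_iff, ← (Pi.basisFun ℂ (Fin k)).span_eq, Submodule.span_le]
    rintro _ ⟨j, rfl⟩
    obtain ⟨a, ha⟩ := h0
    obtain ⟨F, z, hF, hz, hFz⟩ : ∃ (F : MvPolynomial σ ℂ) (z : ℂ), F.IsHomogeneous t ∧ z ≠ 0 ∧
        curveHom μ wt F = Polynomial.C z * Polynomial.X ^ (j : ℕ) := by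
      rcases Nat.eq_zero_or_pos j.1 with hj | hj
      · refine ⟨X a ^ t, μ a ^ t, isHomogeneous_X_pow a t, pow_ne_zero _ (hμ a), ?_⟩
        rw [map_pow, curveHom_X, ha, hj, pow_zero, mul_one, mul_one, map_pow]
      · obtain ⟨b, hb⟩ := h1 (by omega)
        refine ⟨X b ^ j.1 * X a ^ (t - j.1), μ b ^ j.1 * μ a ^ (t - j.1), ?_,
          mul_ne_zero (pow_ne_zero _ (hμ b)) (pow_ne_zero _ (hμ a)), ?_⟩
        · convert (isHomogeneous_X_pow (R := ℂ) b j.1).mul (isHomogeneous_X_pow a (t - j.1)) using 1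
          omega
        · rw [map_mul, map_pow, map_pow, curveHom_X, curveHom_X, ha, hb, map_mul, map_pow, map_pow]
          ring
    refine ⟨z⁻¹ • ⟨F, hF⟩, ?_⟩
    ext i
    rw [map_smul]
    simp only [ψ, LinearMap.comp_apply, Submodule.subtype_apply, AlgHom.toLinearMap_apply, hFz,
      LinearMap.pi_apply, Pi.smul_apply, Polynomial.lcoeff_apply, Polynomial.coeff_C_mul_X_pow,
      Pi.basisFun_apply, Pi.single_apply, smul_eq_mul, Fin.val_inj]
    split_ifs <;> simp [hz]
  rw [ProjSubscheme.hilbertFunction, hker, ψ.quotKerEquivRange.finrank_eq, hsurj, finrank_top,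
    Module.finrank_fin_fun]

theorem sum_eval_pderiv_X_mul [Fintype σ] (v w : σ → ℂ) (a : σ) (G : MvPolynomial σ ℂ) :
    ∑ i, eval v (pderiv i (X a * G)) * w i =
      v a * ∑ i, eval v (pderiv i G) * w i + eval v G * w a := by
  classical
  simp only [Derivation.leibniz, map_add, smul_eq_mul, map_mul, eval_X, add_mul,
    Finset.sum_add_distrib, pderiv_X, Finset.mul_sum]
  congr 1
  · simp [mul_assoc]
  · rw [Finset.sum_eq_single a]
    · simp
    · intro j _ hj; simp [hj.symm]
    · simp

theorem curveScheme_isCurvilinear [Fintype σ] (h1 : 1 < k → ∃ a, wt a = 1)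
    (hwt : Function.Injective wt) (hk : ∀ a, wt a < k) :
    (curveScheme k hμ h0).IsCurvilinear := by
  classical
  intro v hv
  have hk0 : k ≠ 0 := by
    obtain ⟨a, -⟩ := h0
    exact (Nat.zero_le _).trans_lt (hk a) |>.ne'
  have hva : ∀ a, wt a ≠ 0 → v a = 0 := by
    intro a ha
    have hmem : X a ^ k ∈ curveIdeal μ wt k := by
      rw [IsHomogeneous.mem_curveIdeal_iff (isHomogeneous_X_pow a k), map_pow, curveHom_X, mul_pow,
        ← pow_mul]
      refine Dvd.dvd.mul_left (pow_dvd_pow _ ?_) _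
      exact Nat.le_mul_of_pos_left k (Nat.pos_of_ne_zero ha)
    have := hv.2 _ hmem
    rw [map_pow, eval_X] at this
    exact pow_eq_zero_iff hk0 |>.1 this
  obtain ⟨a₀, ha₀⟩ := h0
  have hv0 : v a₀ ≠ 0 := by
    intro h
    refine hv.1 (funext fun a => ?_)
    by_cases ha : wt a = 0
    · rw [hwt (ha.trans ha₀.symm), h]; rfl
    · exact hva a ha
  have hle : (curveScheme k hμ ⟨a₀, ha₀⟩).tangentSpace v ≤ Submodule.span ℂ
      {(Submodule.span ℂ {v}).mkQ fun a => if wt a = 1 then 1 else 0} := by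
    rw [ProjSubscheme.tangentSpace, Submodule.map_le_iff_le_comap]
    intro w hw
    simp only [Submodule.mem_iInf, LinearMap.mem_ker] at hw
    have hw' : ∀ F ∈ curveIdeal μ wt k, ∑ i, eval v (pderiv i F) * w i = 0 := fun F hF => by
      simpa using hw F hF
    have hwa : ∀ a, 2 ≤ wt a → w a = 0 := by
      intro a ha
      obtain ⟨e, he⟩ : ∃ e, wt a = e + 2 := ⟨wt a - 2, by omega⟩
      obtain ⟨b, hb⟩ := h1 (by have := hk a; omega)
      -- The constant makes the binomial below vanish on the curve. Its differential at the only
      -- point forces the coordinate w a of a tangent vector to vanish.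
      set z : ℂ := μ a * μ a₀ ^ (e + 1) / μ b ^ (e + 2) with hz
      have hmem : X a * X a₀ ^ (e + 1) - X b * (C z * X b ^ (e + 1)) ∈ curveIdeal μ wt k := by
        have hhom : (X a * X a₀ ^ (e + 1) - X b * (C z * X b ^ (e + 1)) :
            MvPolynomial σ ℂ).IsHomogeneous (1 + (e + 1)) :=
          ((isHomogeneous_X ℂ a).mul (isHomogeneous_X_pow a₀ _)).sub
            ((isHomogeneous_X ℂ b).mul (isHomogeneous_C_mul_X_pow z b _))
        rw [IsHomogeneous.mem_curveIdeal_iff hhom]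
        have : curveHom μ wt (X a * X a₀ ^ (e + 1) - X b * (C z * X b ^ (e + 1))) = 0 := by
          have hC : curveHom μ wt (C z) = Polynomial.C z := aeval_C _ _
          simp only [map_sub, map_mul, map_pow, curveHom_X, hC, ha₀, hb, he, pow_zero, mul_one,
            pow_one]
          have hzb : Polynomial.C z * Polynomial.C (μ b) ^ (e + 2) =
              Polynomial.C (μ a) * Polynomial.C (μ a₀) ^ (e + 1) := by
            simp only [← map_pow, ← map_mul]
            congr 1
            rw [hz, div_mul_cancel₀ _ (pow_ne_zero _ (hμ b))]
          linear_combination (-Polynomial.X ^ (e + 2)) * hzb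
        rw [this]
        exact dvd_zero _
      have hD := hw' _ hmem
      simp_rw [map_sub, sub_mul] at hD
      rw [Finset.sum_sub_distrib, sum_eval_pderiv_X_mul, sum_eval_pderiv_X_mul,
        hva a (by omega), hva b (by omega)] at hD
      simp only [map_mul, map_pow, eval_X, hva b (by omega), eval_C] at hD
      simpa [hv0] using hD
    rw [Submodule.mem_comap, Submodule.mem_span_singleton]
    -- Without a coordinate of weight 1 the spanning vector is zero, and the default 0 serves.
    refine ⟨if h : ∃ a, wt a = 1 then w h.choose else 0, ?_⟩
    rw [← map_smul, ← sub_eq_zero, ← map_sub, Submodule.mkQ_apply, Submodule.Quotient.mk_eq_zero,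
      Submodule.mem_span_singleton]
    refine ⟨-(w a₀ / v a₀), funext fun a => ?_⟩
    simp only [Pi.smul_apply, Pi.sub_apply, smul_eq_mul]
    rcases Nat.lt_or_ge (wt a) 2 with ha | ha
    · interval_cases hwa' : wt a
      · obtain rfl := hwt (hwa'.trans ha₀.symm)
        simp [hv0]
      · have hex : ∃ a, wt a = 1 := ⟨a, hwa'⟩
        have : hex.choose = a := hwt (hex.choose_spec.trans hwa'.symm)
        rw [dif_pos hex, this, hva a (by omega)]
        simp
    · rw [hva a (by omega), hwa a ha, if_neg (by omega)]
      simp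
  refine (Submodule.finrank_mono hle).trans ?_
  exact (finrank_span_le_card _).trans (by rw [Set.toFinset_singleton, Finset.card_singleton])

/-- Coordinates pull back to multiples of distinct powers s^j with j < k, independent modulo s^k, so
no hyperplane contains the scheme. -/
theorem curveScheme_span [Fintype σ] (hwt : Function.Injective wt) (hk : ∀ a, wt a < k) :
    (curveScheme k hμ h0).span = Set.univ := by
  refine Set.eq_univ_of_forall fun v F hF hF1 => ?_
  have hmem : F ∈ homogeneousSubmodule σ ℂ 1 := hF1
  rw [homogeneousSubmodule_one_eq_span_X, Submodule.mem_span_range_iff_exists_fun] at hmem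
  obtain ⟨c, rfl⟩ := hmem
  have hdvd := (IsHomogeneous.mem_curveIdeal_iff hF1).1 hF
  rw [Polynomial.X_pow_dvd_iff] at hdvd
  have hc : ∀ a, c a = 0 := by
    intro a
    have := hdvd (wt a) (hk a)
    simp only [map_sum, map_smul, curveHom_X, Polynomial.finsetSum_coeff, Polynomial.coeff_smul,
      Polynomial.coeff_C_mul_X_pow, smul_eq_mul] at this
    rw [Finset.sum_eq_single a] at this
    · simpa [hμ a] using this
    · intro b _ hb
      rw [if_neg fun h => hb (hwt h.symm), mul_zero]
    · simp
  simp [hc]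

end MonomialCurve

/-! ### A curvilinear scheme spanning the whole space. -/

section Nonempty

variable {n d : ℕ}

/-- Weights separating the monomials of degree `d`. -/
def expoWeight (a : Expo n d) : ℕ := ∑ i : Fin n, a.1 i.succ * (d + 1) ^ (i : ℕ)

theorem Expo.apply_le (a : Expo n d) (i : Fin (n + 1)) : a.1 i ≤ d := by
  conv_rhs => rw [← a.sum_eq]
  exact Finset.single_le_sum (f := fun i => a.1 i) (fun _ _ => Nat.zero_le _) (Finset.mem_univ i)

/-- The exponents other than that of x_0 are digits in base d + 1, and the total degree recovers the
missing one. Injectivity and the bound on the weights follow. -/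
theorem expoWeight_eq (a : Expo n d) : expoWeight a =
    (finFunctionFinEquiv fun i : Fin n =>
      (⟨a.1 i.succ, Nat.lt_succ_of_le (a.apply_le _)⟩ : Fin (d + 1)) : ℕ) := by
  rw [finFunctionFinEquiv_apply, expoWeight]

theorem expoWeight_lt (a : Expo n d) : expoWeight a < (d + 1) ^ n := by
  rw [expoWeight_eq]
  exact Fin.is_lt _

theorem expoWeight_injective : Function.Injective (expoWeight : Expo n d → ℕ) := by
  intro a b hab
  rw [expoWeight_eq, expoWeight_eq, Fin.val_inj, finFunctionFinEquiv.apply_eq_iff_eq] at hab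
  have hs : ∀ i : Fin n, a.1 i.succ = b.1 i.succ := fun i =>
    congrArg Fin.val (congrFun hab i)
  have ha := a.sum_eq
  have hb := b.sum_eq
  rw [Fin.sum_univ_succ] at ha hb
  simp_rw [hs] at ha
  refine Subtype.ext (Finsupp.ext fun i => ?_)
  refine Fin.cases ?_ hs i
  omega

theorem exists_expoWeight_eq_zero : ∃ a : Expo n d, expoWeight a = 0 := by
  refine ⟨Expo.ofDegree (Finsupp.single 0 d) (by simp), ?_⟩
  simp [expoWeight, Expo.ofDegree, Fin.succ_ne_zero]

theorem exists_expoWeight_eq_one (hd : 1 ≤ d) (h : 1 < (d + 1) ^ n) :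
    ∃ a : Expo n d, expoWeight a = 1 := by
  obtain ⟨m, rfl⟩ : ∃ m, n = m + 1 := ⟨n - 1, by
    rcases n with - | n
    · simp at h
    · simp⟩
  refine ⟨Expo.ofDegree (Finsupp.single 0 (d - 1) + Finsupp.single 1 1) (by
    rw [map_add, Finsupp.degree_single, Finsupp.degree_single]; omega), ?_⟩
  rw [expoWeight, Finset.sum_eq_single 0]
  · simp [Expo.ofDegree]
  · intro i _ hi
    have h1 : (1 : Fin (m + 2)) ≠ i.succ := fun h => hi (Fin.succ_injective _ (by
      rw [← h]; rfl))
    simp [Expo.ofDegree, h1]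
  · simp

theorem prod_pow_expoWeight (s : ℂ) (a : Expo n d) :
    ∏ i, (Fin.cons 1 (fun j : Fin n => s ^ (d + 1) ^ (j : ℕ)) : Fin (n + 1) → ℂ) i ^ a.1 i =
      s ^ expoWeight a := by
  rw [Fin.prod_univ_succ, expoWeight, ← Finset.prod_pow_eq_pow_sum]
  simp only [Fin.cons_zero, one_pow, one_mul, Fin.cons_succ]
  refine Finset.prod_congr rfl fun i _ => ?_
  rw [← pow_mul, mul_comm]

theorem eval_map_coneHom {σ : Type*} (μ : σ → ℂ) (wt : σ → ℕ) (F : MvPolynomial σ ℂ) (s z : ℂ) :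
    ((coneHom μ wt F).map (Polynomial.evalRingHom s)).eval z =
      eval (fun a => z * (μ a * s ^ wt a)) F := by
  induction F using MvPolynomial.induction_on with
  | C r =>
    rw [coneHom, aeval_C, eval_C, show algebraMap ℂ (Polynomial (Polynomial ℂ)) r =
        Polynomial.C (Polynomial.C r) from rfl]
    simp
  | add p q hp hq => rw [map_add, Polynomial.map_add, Polynomial.eval_add, hp, hq, map_add]
  | mul_X p i hp =>
    rw [map_mul, Polynomial.map_mul, Polynomial.eval_mul, hp, map_mul, eval_X]
    congr 1
    rw [coneHom, aeval_X]
    simp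

/-- With r^d = z, the cone point with parameters (s, z) is the `d`-th power of the linear form with
coefficients r and r·s^((d+1)^j). Hence the cone over the curve lies in the Veronese cone. -/
theorem vanishingIdeal_le_curveIdeal (hd : 1 ≤ d) (k : ℕ) :
    vanishingIdeal ℂ (veroneseCone n d) ≤
      curveIdeal (fun a : Expo n d => (a.1.multinomial : ℂ)) expoWeight k := by
  intro F hF
  rw [mem_curveIdeal_iff]
  intro t
  rw [← coeff_coneHom]
  suffices h : coneHom (fun a : Expo n d => (a.1.multinomial : ℂ)) expoWeight F = 0 by
    rw [h]; simp
  refine Polynomial.ext fun t => Polynomial.funext fun s => ?_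
  have hs : (coneHom (fun a : Expo n d => (a.1.multinomial : ℂ)) expoWeight F).map
      (Polynomial.evalRingHom s) = 0 := by
    refine Polynomial.funext fun z => ?_
    obtain ⟨r, hr⟩ := IsAlgClosed.exists_pow_nat_eq z (n := d) (by omega)
    rw [eval_map_coneHom, Polynomial.eval_zero]
    have hv : (fun a : Expo n d => z * ((a.1.multinomial : ℂ) * s ^ expoWeight a)) =
        coords n d (linForm (fun i => r * (Fin.cons 1 (fun j : Fin n => s ^ (d + 1) ^ (j : ℕ)) :
          Fin (n + 1) → ℂ) i) ^ d) := by
      ext a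
      rw [coords, coeff_linForm_pow]
      simp_rw [mul_pow]
      rw [Finset.prod_mul_distrib, Finset.prod_pow_eq_pow_sum, a.sum_eq, hr, prod_pow_expoWeight]
      ring
    rw [hv]
    exact mem_vanishingIdeal_iff.1 hF _ ⟨_, linForm_isHomogeneous _, rfl⟩
  have := congrArg (fun p => Polynomial.coeff p t) hs
  simpa [Polynomial.coeff_map] using this

theorem curvilinearLengths_nonempty (hd : 1 ≤ d) (P : MvPolynomial (Fin (n + 1)) ℂ) :
    (curvilinearLengths n d P).Nonempty := by
  have hμ : ∀ a : Expo n d, (a.1.multinomial : ℂ) ≠ 0 := fun a => multinomial_ne_zero a.1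
  refine ⟨(d + 1) ^ n, curveScheme ((d + 1) ^ n) hμ exists_expoWeight_eq_zero,
    curveScheme_isZeroDimOfDegree hμ _ (exists_expoWeight_eq_one hd),
    curveScheme_isCurvilinear hμ _ (exists_expoWeight_eq_one hd) expoWeight_injective
      expoWeight_lt, vanishingIdeal_le_curveIdeal hd _, ?_⟩
  rw [curveScheme_span hμ _ expoWeight_injective expoWeight_lt]
  exact Set.mem_univ _

end Nonempty

end CurvilinearRank

end

/-- The first two conjuncts say that the minima defining the two ranks are over nonempty sets. -/
theorem theorem1 (n d : ℕ) (hd : 1 ≤ d) (P : MvPolynomial (Fin (n + 1)) ℂ)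
    (hP : P.IsHomogeneous d) (hP0 : P ≠ 0) :
    (CurvilinearRank.powerSumLengths n d P).Nonempty ∧
    (CurvilinearRank.curvilinearLengths n d P).Nonempty ∧
    (CurvilinearRank.rank n d P : ℤ) ≤
      ((CurvilinearRank.curvilinearRank n d P : ℤ) - 1) * d + 2
        - CurvilinearRank.curvilinearRank n d P := by
  have hne := CurvilinearRank.curvilinearLengths_nonempty hd P
  obtain ⟨hk1, r, hr, hrk⟩ :=
    CurvilinearRank.exists_mem_powerSumLengths_le hd hP hP0 (Nat.sInf_mem hne)
  refine ⟨⟨r, hr⟩, hne, ?_⟩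
  have hle : CurvilinearRank.rank n d P ≤ r := Nat.sInf_le hr
  change 1 ≤ CurvilinearRank.curvilinearRank n d P at hk1
  change r ≤ (CurvilinearRank.curvilinearRank n d P - 1) * (d - 1) + 1 at hrk
  have h := hle.trans hrk
  zify [hk1, hd] at h
  linarith
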